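/- Let $\mathrm{GF}(q)$ be a finite field with $q\neq 2$, and let $D,N$ be integers with $N>2D\ge 6$. Let $\Gamma$ be the bilinear forms graph $H_q(D,N-D)$: its vertex set $X$ is the set of $D\times(N-D)$ matrices over $\mathrm{GF}(q)$, and two vertices are adjacent whenever their difference has rank one. Let $\partial$ be the path-length distance of $\Gamma$; for a vertex $x$ put $\Gamma_i(x)=\{z\in X : \partial(x,z)=i\}$ and $\Gamma(x)=\Gamma_1(x)$. Let $V=\mathbb R^X$; for $x\in X$ let $\hat x\in V$ have $x$-coordinate $1$ and all other coordinates $0$, and put $\widehat\Omega=\sum_{z\in\Omega}\hat z$ for $\Omega\subseteq X$. Let $A$ be the adjacency matrix of $\Gamma$ and let $E$ be the primitive idempotent of $A$ associated with its second largest eigenvalue $\theta_1$, that is, the matrix that acts as the identity on the $\theta_1$-eigenspace of $A$ and as $0$ on every other eigenspace of $A$. For $x,y\in X$ with $k=\partial(x,y)$, $2\le k\le D-1$, the $y$-partition $O_1,\dots,O_6$ of $\Gamma(x)$ is defined as follows. $O_1=\Gamma(x)\cap\Gamma_{k-1}(y)$ and $O_6=\Gamma(x)\cap\Gamma_{k+1}(y)$.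 For $z\in\Gamma(x)\cap\Gamma_k(y)$ write $$m(z)=|\Gamma(x)\cap\Gamma(z)\cap\Gamma_{k-1}(y)|,\qquad n(z)=|\Gamma(x)\cap\Gamma(z)\cap\Gamma_{k+1}(y)|.$$ Then $O_2,O_3,O_4,O_5$ consist of those $z\in\Gamma(x)\cap\Gamma_k(y)$ for which $(m(z),n(z))$ equals, respectively, $$(2q^{k-1},\,0),\qquad (2q^{k-1}-1,\,0),\qquad (q^{k-1},\,q^D-q^k),\qquad (q^{k-1},\,q^{N-D}-q^k).$$ Let $S(x,y)$ be the span of $E\widehat O_1,\dots,E\widehat O_6$. Proposition. Let $x,y\in X$ with $2\le\partial(x,y)\le D-1$. Let $O_1,\dots,O_6$ be the $y$-partition of $\Gamma(x)$ and $O_1',\dots,O_6'$ the $x$-partition of $\Gamma(y)$. Then the sets $O_1,\dots,O_6$ are nonempty, mutually disjoint and have union $\Gamma(x)$, and $$S(x,y)=S(y,x).$$ Moreover, $\{E\widehat O_i\}_{i=1}^6$ and $\{E\widehat O_i'\}_{i=1}^6$ are each linearly independent, so that both are bases of this common subspace, which has dimension $6$, is contained in $EV$, and contains $E\hat x$ and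 $E\hat y$. -/

import Mathlib

namespace BilinearForms

noncomputable section

/-! ### Eigenvalues and primitive idempotents of a finite graph -/

/-- The adjacency matrix of `G`, in `Mat_X(ℝ)`. -/
def adj {X : Type*} (G : SimpleGraph X) : Matrix X X ℝ :=
  open Classical in G.adjMatrix ℝ

/-- The set of eigenvalues of a real matrix, that is, the set of those `θ` for which there is a
nonzero vector `v` with `B v = θ v`. -/
def eigenvalues {X : Type*} [Fintype X] (B : Matrix X X ℝ) : Set ℝ :=
  {θ | ∃ v : X → ℝ, v ≠ 0 ∧ B.mulVec v = θ • v}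

/-- The second largest of the (distinct) eigenvalues of `B`: the largest eigenvalue other than the
largest one. -/
def secondLargestEigenvalue {X : Type*} [Fintype X] (B : Matrix X X ℝ) : ℝ :=
  sSup (eigenvalues B \ {sSup (eigenvalues B)})

/-- The matrix of the orthogonal projection of `ℝ^X` onto the `θ`-eigenspace of `B`. For a
symmetric matrix `B` it is the primitive idempotent of `B` associated with `θ`, see
`eq_primitiveIdempotent_iff`. -/
def primitiveIdempotent {X : Type*} [Fintype X] [DecidableEq X] (B : Matrix X X ℝ) (θ : ℝ) :
    Matrix X X ℝ :=
  Matrix.toEuclideanLin.symm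
    ((Module.End.eigenspace (Matrix.toEuclideanLin B) θ).starProjection :
      EuclideanSpace ℝ X →ₗ[ℝ] EuclideanSpace ℝ X)

/-- For symmetric `B`, the matrix `primitiveIdempotent B θ` is the unique matrix that acts as the
identity on the `θ`-eigenspace of `B` and as zero on every other eigenspace of `B`. -/
theorem eq_primitiveIdempotent_iff {X : Type*} [Fintype X] [DecidableEq X] {B : Matrix X X ℝ}
    (hB : B.IsSymm) (θ : ℝ) (E : Matrix X X ℝ) :
    E = primitiveIdempotent B θ ↔
      (∀ v : X → ℝ, B.mulVec v = θ • v → E.mulVec v = v) ∧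
      (∀ (η : ℝ) (v : X → ℝ), η ≠ θ → B.mulVec v = η • v → E.mulVec v = 0) := by
  have hH : B.IsHermitian := by
    rw [Matrix.IsHermitian, Matrix.conjTranspose_eq_transpose_of_trivial]; exact hB
  have key : ∀ (v : EuclideanSpace ℝ X),
      Matrix.toEuclideanLin (primitiveIdempotent B θ) v =
        (Module.End.eigenspace (Matrix.toEuclideanLin B) θ).starProjection v := by
    intro v
    simp [primitiveIdempotent]
  have hmem : ∀ (η : ℝ) (v : X → ℝ), B.mulVec v = η • v →
      (WithLp.toLp 2 v : EuclideanSpace ℝ X) ∈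
        Module.End.eigenspace (Matrix.toEuclideanLin B) η := by
    intro η v hv
    rw [Module.End.mem_eigenspace_iff, Matrix.toLpLin_toLp, Matrix.toLin'_apply, hv,
      WithLp.toLp_smul]
  have h1 : ∀ v : X → ℝ, B.mulVec v = θ • v → (primitiveIdempotent B θ).mulVec v = v := by
    intro v hv
    have := key (WithLp.toLp 2 v)
    rw [Submodule.starProjection_eq_self_iff.2 (hmem θ v hv), Matrix.toLpLin_toLp] at this
    exact congrArg WithLp.ofLp this
  have h2 : ∀ (η : ℝ) (v : X → ℝ), η ≠ θ → B.mulVec v = η • v →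
      (primitiveIdempotent B θ).mulVec v = 0 := by
    intro η v hη hv
    have := key (WithLp.toLp 2 v)
    have hperp : (WithLp.toLp 2 v : EuclideanSpace ℝ X) ∈
        (Module.End.eigenspace (Matrix.toEuclideanLin B) θ)ᗮ := by
      rw [Submodule.mem_orthogonal]
      intro u hu
      exact (Matrix.isSymmetric_toEuclideanLin_iff.2 hH).orthogonalFamily_eigenspaces
        (i := θ) (j := η) hη.symm ⟨u, hu⟩ ⟨_, hmem η v hv⟩
    rw [(Submodule.starProjection_apply_eq_zero_iff _).2 hperp, Matrix.toLpLin_toLp] at this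
    exact congrArg WithLp.ofLp this
  constructor
  · rintro rfl
    exact ⟨h1, h2⟩
  · rintro ⟨g1, g2⟩
    apply Matrix.toEuclideanLin.injective
    apply hH.eigenvectorBasis.toBasis.ext
    intro j
    have hv := hH.mulVec_eigenvectorBasis j
    rw [OrthonormalBasis.coe_toBasis]
    have : E.mulVec (hH.eigenvectorBasis j) =
        (primitiveIdempotent B θ).mulVec (hH.eigenvectorBasis j) := by
      by_cases h : hH.eigenvalues j = θ
      · rw [h] at hv
        rw [g1 _ hv, h1 _ hv]
      · rw [g2 _ _ h hv, h2 _ _ h hv]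
    exact congrArg (WithLp.toLp 2) this

/-- The characteristic vector `Ω̂ = ∑_{z ∈ Ω} ẑ` in `ℝ^X`, where `ẑ` has `z`-coordinate `1` and all
other coordinates `0`. -/
def hat {X : Type*} [DecidableEq X] (Ω : Finset X) : X → ℝ :=
  ∑ z ∈ Ω, Pi.single z 1

/-- `Γ_i(x)`, the set of vertices at path-length distance `i` from `x`. -/
def sphere {X : Type*} [Fintype X] (G : SimpleGraph X) (i : ℕ) (x : X) : Finset X :=
  open Classical in Finset.univ.filter fun y => G.dist x y = i

/-! ### The bilinear forms graph -/

/-- The vertex set of the bilinear forms graph: the `D × (N - D)` matrices over `F`. -/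
abbrev Vertex (F : Type*) (D N : ℕ) : Type _ := Matrix (Fin D) (Fin (N - D)) F

/-- The bilinear forms graph `H_q(D, N - D)`, with `q = |F|`: two matrices are adjacent whenever
their difference has rank one. -/
def graph (F : Type*) [Field F] (D N : ℕ) : SimpleGraph (Vertex F D N) where
  Adj a b := (a - b).rank = 1
  symm := ⟨fun a b h => by
    rw [← neg_sub a b, ← neg_one_smul F (a - b),
      Matrix.rank_smul_of_mem_nonZeroDivisors _ (by simp)]
    exact h⟩
  loopless := ⟨fun a h => by simp at h⟩

/-- The primitive idempotent of the bilinear forms graph that is associated with its second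
largest eigenvalue `θ_1`. -/
def idem (F : Type*) [Field F] [Fintype F] [DecidableEq F] (D N : ℕ) :
    Matrix (Vertex F D N) (Vertex F D N) ℝ :=
  primitiveIdempotent (adj (graph F D N)) (secondLargestEigenvalue (adj (graph F D N)))

/-- Those `z ∈ Γ(x) ∩ Γ_k(y)`, `k = ∂(x, y)`, that have exactly `m` neighbours in
`Γ(x) ∩ Γ_{k-1}(y)` and exactly `n` neighbours in `Γ(x) ∩ Γ_{k+1}(y)`. -/
def middlePart {X : Type*} [Fintype X] [DecidableEq X] (G : SimpleGraph X) (x y : X) (m n : ℕ) :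
    Finset X :=
  (sphere G 1 x ∩ sphere G (G.dist x y) y).filter fun z =>
    (sphere G 1 x ∩ sphere G 1 z ∩ sphere G (G.dist x y - 1) y).card = m ∧
    (sphere G 1 x ∩ sphere G 1 z ∩ sphere G (G.dist x y + 1) y).card = n

/-- The `y`-partition `O_1, …, O_6` of `Γ(x)`, indexed from `0` to `5`. It is used for
`2 ≤ k ≤ D - 1 < N - D` only, where `k = ∂(x, y)`; then no subtraction below is truncated. -/
def part {F : Type*} [Field F] [Fintype F] [DecidableEq F] {D N : ℕ} (x y : Vertex F D N) :
    Fin 6 → Finset (Vertex F D N) :=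
  let q := Fintype.card F
  let k := (graph F D N).dist x y
  ![sphere (graph F D N) 1 x ∩ sphere (graph F D N) (k - 1) y,
    middlePart (graph F D N) x y (2 * q ^ (k - 1)) 0,
    middlePart (graph F D N) x y (2 * q ^ (k - 1) - 1) 0,
    middlePart (graph F D N) x y (q ^ (k - 1)) (q ^ D - q ^ k),
    middlePart (graph F D N) x y (q ^ (k - 1)) (q ^ (N - D) - q ^ k),
    sphere (graph F D N) 1 x ∩ sphere (graph F D N) (k + 1) y]

/-- The vectors `E Ô_i`. -/
def partVec {F : Type*} [Field F] [Fintype F] [DecidableEq F] {D N : ℕ} (x y : Vertex F D N)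
    (i : Fin 6) : Vertex F D N → ℝ :=
  (idem F D N).mulVec (hat (part x y i))

/-- The subspace `S(x, y)` of `ℝ^X` spanned by the vectors `E Ô_i`. -/
def S {F : Type*} [Field F] [Fintype F] [DecidableEq F] {D N : ℕ} (x y : Vertex F D N) :
    Submodule ℝ (Vertex F D N → ℝ) :=
  Submodule.span ℝ (Set.range (partVec x y))

/-- The subspace `EV`. -/
def EV (F : Type*) [Field F] [Fintype F] [DecidableEq F] (D N : ℕ) :
    Submodule ℝ (Vertex F D N → ℝ) :=
  LinearMap.range (idem F D N).mulVecLin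

end

end BilinearForms

set_option linter.unusedSectionVars false

/-! Every vertex of Γ(x) is x + u vᵀ with u, v nonzero, the pair (u, v) being unique up to (cu,
c⁻¹v). Factor y - x = PQ through F^k. The rank of PQ - u vᵀ depends only on whether u lies in the
column space of P, whether v lies in the row space of Q, and, if u = Pp and v = rQ, whether p·r = 1.
Two rank one matrices whose difference has rank one share their column line or their row line, so
m(z) and n(z) follow by inclusion-exclusion (`card_common_neighbours`). The outcome is that O_1, …,
O_6 are six positions of (u, v): both inside with p·r = 1, with p·r = 0, with any other p·r; only u
inside; only v inside; neither (`mem_part_iff_kind`).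

The graph is a Cayley graph on the additive group of matrices. The character z ↦ ψ(tr Cᵀz) has an
eigenvalue that depends only on rank C and strictly decreases with it. Hence θ_1 belongs to rank C =
1, and on the Fourier side E is restriction to C = abᵀ (`fourier_idem_mulVec`). Everything becomes a
statement about functions of (a, b).

Put α = aP, γ = Qb and β = α·γ = aᵀ(y - x)b. Up to the factor ψ(aᵀxb), the transform of each Ô_i
depends only on which of α, γ, β vanish and on ψ(β). Suitable unions of the O_i have transforms that
can be summed in closed form, and from them one recovers the six functions `basisFun`
(`basisFun_mem_span`). These are independent when 2 ≤ k < D and q ≠ 2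
(`linearIndependent_basisFun`), so by dimension they and the six transforms are bases of one space.

Exchanging x and y replaces β by -β and multiplies the common factor by ψ(β), which maps this space
to itself (`span_basisFun_le_swap`); that gives S(x, y) = S(y, x). The transform of x̂ is the first
of the six functions, so Ex̂ lies in S(x, y), and Ey̌ = Eŷ follows by symmetry. -/

namespace BilinearForms

open Matrix

/-! ### Rank factorizations and rank one perturbations -/

section Rank

variable {F : Type*} [Field F] {m n κ : Type*} [Fintype m] [Fintype n] [Fintype κ]

theorem rank_add_le (A B : Matrix m n F) : (A + B).rank ≤ A.rank + B.rank := by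
  rw [Matrix.rank, Matrix.rank, Matrix.rank, Matrix.mulVecLin_add]
  refine (Submodule.finrank_mono ?_).trans (Submodule.finrank_add_le_finrank_add_finrank _ _)
  rintro _ ⟨v, rfl⟩
  exact Submodule.add_mem_sup ⟨v, rfl⟩ ⟨v, rfl⟩

theorem rank_neg (A : Matrix m n F) : (-A).rank = A.rank := by
  rw [← neg_one_smul F, Matrix.rank_smul_of_mem_nonZeroDivisors _ (by simp)]

theorem rank_sub_comm (A B : Matrix m n F) : (A - B).rank = (B - A).rank := by
  rw [← neg_sub, rank_neg]

theorem rank_sub_triangle (A B C : Matrix m n F) :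
    (A - C).rank ≤ (A - B).rank + (B - C).rank := by
  have h := rank_add_le (A - B) (B - C)
  rwa [sub_add_sub_cancel] at h

theorem eq_zero_of_rank_eq_zero {A : Matrix m n F} (h : A.rank = 0) : A = 0 := by
  have h1 : LinearMap.range A.mulVecLin = ⊥ := Submodule.finrank_eq_zero.1 h
  have h2 : A.mulVecLin = 0 := LinearMap.range_eq_bot.1 h1
  classical
  ext i j
  have := congrFun (LinearMap.congr_fun h2 (Pi.single j 1)) i
  simpa using this

theorem rank_mul_of_mulVec_injective {A : Matrix m κ F} (hA : Function.Injective A.mulVec)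
    (B : Matrix κ n F) : (A * B).rank = B.rank := by
  rw [Matrix.rank, Matrix.rank, Matrix.mulVecLin_mul, LinearMap.range_comp]
  exact (LinearEquiv.finrank_eq (Submodule.equivMapOfInjective _ hA _)).symm

theorem rank_eq_card_of_vecMul_injective {B : Matrix κ n F}
    (hB : Function.Injective fun r => r ᵥ* B) : B.rank = Fintype.card κ := by
  have := Matrix.vecMul_injective_iff.1 hB
  exact this.rank_matrix

theorem rank_mul_of_injective {A : Matrix m κ F} {B : Matrix κ n F}
    (hA : Function.Injective A.mulVec) (hB : Function.Injective fun r => r ᵥ* B) :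
    (A * B).rank = Fintype.card κ := by
  rw [rank_mul_of_mulVec_injective hA, rank_eq_card_of_vecMul_injective hB]

theorem rank_mul_mul_of_injective {A : Matrix m κ F} {B : Matrix κ n F} (X : Matrix κ κ F)
    (hA : Function.Injective A.mulVec) (hB : Function.Injective fun r => r ᵥ* B) :
    (A * X * B).rank = X.rank := by
  rw [Matrix.mul_assoc, rank_mul_of_mulVec_injective hA, ← Matrix.rank_transpose,
    Matrix.transpose_mul, rank_mul_of_mulVec_injective, Matrix.rank_transpose]
  intro r s h
  apply hB
  simpa [Matrix.mulVec_transpose] using h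

/-- Every matrix of rank `k` factors through `F^k`. -/
theorem exists_rank_factorization [DecidableEq m] [DecidableEq n] (A : Matrix m n F) {k : ℕ}
    (hk : A.rank = k) :
    ∃ (P : Matrix m (Fin k) F) (Q : Matrix (Fin k) n F), A = P * Q ∧
      Function.Injective P.mulVec ∧ Function.Injective fun r => r ᵥ* Q := by
  let R := LinearMap.range A.mulVecLin
  have hR : Module.finrank F R = k := hk
  let e : R ≃ₗ[F] (Fin k → F) := LinearEquiv.ofFinrankEq _ _ (by simp [hR])
  let f : (Fin k → F) →ₗ[F] (m → F) := R.subtype ∘ₗ e.symm.toLinearMap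
  let g : (n → F) →ₗ[F] (Fin k → F) := e.toLinearMap ∘ₗ A.mulVecLin.rangeRestrict
  have hfg : f ∘ₗ g = A.mulVecLin := by
    ext; simp [f, g]
  have hP : Function.Injective (LinearMap.toMatrix' f).mulVec := by
    have : (LinearMap.toMatrix' f).mulVec = f := by
      ext v; rw [LinearMap.toMatrix'_mulVec]
    rw [this]
    exact Subtype.val_injective.comp e.symm.injective
  have hQ : Function.Surjective (LinearMap.toMatrix' g).mulVec := by
    have : (LinearMap.toMatrix' g).mulVec = g := by
      ext v; rw [LinearMap.toMatrix'_mulVec]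
    rw [this]
    exact e.surjective.comp A.mulVecLin.surjective_rangeRestrict
  refine ⟨LinearMap.toMatrix' f, LinearMap.toMatrix' g, ?_, hP, ?_⟩
  · rw [← LinearMap.toMatrix'_comp, hfg, ← Matrix.toLin'_apply', LinearMap.toMatrix'_toLin']
  · intro r s h
    -- A vector is determined by its dot products, and every test vector has the form Qz because g
    -- is surjective.
    apply dotProduct_eq
    intro w
    obtain ⟨z, rfl⟩ := hQ w
    rw [Matrix.dotProduct_mulVec, Matrix.dotProduct_mulVec]
    exact congrArg (· ⬝ᵥ z) h

theorem vecMulVec_eq_zero_iff {u : m → F} {v : n → F} : vecMulVec u v = 0 ↔ u = 0 ∨ v = 0 := by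
  constructor
  · intro h
    by_contra! hc
    obtain ⟨i, hi⟩ := Function.ne_iff.1 hc.1
    obtain ⟨j, hj⟩ := Function.ne_iff.1 hc.2
    have := congrFun (congrFun h i) j
    simp [vecMulVec_apply] at this
    tauto
  · rintro (rfl | rfl) <;> ext <;> simp [vecMulVec_apply]

theorem rank_vecMulVec_eq_one {u : m → F} {v : n → F} (hu : u ≠ 0) (hv : v ≠ 0) :
    (vecMulVec u v).rank = 1 := by
  refine le_antisymm (rank_vecMulVec_le u v) (Nat.one_le_iff_ne_zero.2 fun h => ?_)
  rcases vecMulVec_eq_zero_iff.1 (eq_zero_of_rank_eq_zero h) with h | h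
  · exact hu h
  · exact hv h

theorem rank_eq_one_iff {A : Matrix m n F} :
    A.rank = 1 ↔ ∃ u v, u ≠ 0 ∧ v ≠ 0 ∧ A = vecMulVec u v := by
  classical
  constructor
  · intro h
    obtain ⟨P, Q, rfl, hP, hQ⟩ := exists_rank_factorization A h
    have hPQ : P * Q = vecMulVec (P.col 0) (Q.row 0) := by
      ext i j
      simp [Matrix.mul_apply, vecMulVec_apply]
    refine ⟨P.col 0, Q.row 0, ?_, ?_, hPQ⟩
    · intro h0
      rw [hPQ, vecMulVec_eq_zero_iff.2 (by tauto)] at h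
      simp at h
    · intro h0
      rw [hPQ, vecMulVec_eq_zero_iff.2 (by tauto)] at h
      simp at h
  · rintro ⟨u, v, hu, hv, rfl⟩
    exact rank_vecMulVec_eq_one hu hv

theorem vecMulVec_eq_vecMulVec_iff {u u' : m → F} {v v' : n → F} (hu : u ≠ 0) (hv : v ≠ 0) :
    vecMulVec u' v' = vecMulVec u v ↔ ∃ c : F, c ≠ 0 ∧ u' = c • u ∧ v' = c⁻¹ • v := by
  constructor
  · intro h
    obtain ⟨i, hi⟩ := Function.ne_iff.1 hu
    obtain ⟨j, hj⟩ := Function.ne_iff.1 hv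
    have h' : ∀ a b, u' a * v' b = u a * v b := fun a b => congrFun (congrFun h a) b
    simp only [Pi.zero_apply] at hi hj
    have hij : u' i * v' j ≠ 0 := by rw [h']; exact mul_ne_zero hi hj
    have hi' := left_ne_zero_of_mul hij
    have hj' := right_ne_zero_of_mul hij
    refine ⟨u' i / u i, div_ne_zero hi' hi, ?_, ?_⟩
    · ext a
      have h1 := h' a j
      have h2 := h' i j
      simp only [Pi.smul_apply, smul_eq_mul]
      field_simp
      apply mul_right_cancel₀ hj'
      linear_combination u i * h1 - u a * h2
    · ext b
      have h1 := h' i b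
      simp only [Pi.smul_apply, smul_eq_mul]
      field_simp
      linear_combination h1
  · rintro ⟨c, hc, rfl, rfl⟩
    ext a b
    simp [vecMulVec_apply]
    field_simp

variable {P : Matrix m κ F} {Q : Matrix κ n F}

theorem vecMulVec_mulVec_vecMul (p r : κ → F) :
    vecMulVec (P *ᵥ p) (r ᵥ* Q) = P * vecMulVec p r * Q := by
  rw [Matrix.mul_vecMulVec, Matrix.vecMulVec_mul]

/-- The determinant of 1 - p rᵀ is 1 - p·r. -/
theorem rank_one_sub_vecMulVec [DecidableEq κ] {p r : κ → F} (h : p ⬝ᵥ r ≠ 1) :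
    (1 - vecMulVec p r).rank = Fintype.card κ := by
  apply Matrix.rank_of_det_ne_zero
  have : (1 - vecMulVec p r).det = 1 - p ⬝ᵥ r := by
    have := Matrix.det_one_add_replicateCol_mul_replicateRow (ι := Unit) (-p) r
    rw [← Matrix.vecMulVec_eq, Matrix.neg_vecMulVec, ← sub_eq_add_neg] at this
    rw [this, dotProduct_neg, sub_eq_add_neg, dotProduct_comm]
  rw [this]
  exact sub_ne_zero.2 (Ne.symm h)

/-- The vector p lies in the kernel, and a rank one perturbation of the identity loses at most one.
-/
theorem rank_one_sub_vecMulVec_add_one [DecidableEq κ] {p r : κ → F} (h : p ⬝ᵥ r = 1) :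
    (1 - vecMulVec p r).rank + 1 = Fintype.card κ := by
  have hlow : Fintype.card κ ≤ (1 - vecMulVec p r).rank + 1 := by
    have h1 := rank_add_le (1 - vecMulVec p r) (vecMulVec p r)
    rw [sub_add_cancel, Matrix.rank_one] at h1
    exact h1.trans (Nat.add_le_add_left (rank_vecMulVec_le p r) _)
  have hp : p ≠ 0 := by
    rintro rfl
    simp at h
  have hlt : (1 - vecMulVec p r).rank < Fintype.card κ := by
    refine lt_of_le_of_ne (Matrix.rank_le_card_width _) fun he => ?_
    have hker := LinearMap.finrank_range_add_finrank_ker (1 - vecMulVec p r).mulVecLin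
    rw [← Matrix.rank, he, Module.finrank_fintype_fun_eq_card] at hker
    have h0 : Module.finrank F (LinearMap.ker (1 - vecMulVec p r).mulVecLin) = 0 := by omega
    rw [Submodule.finrank_eq_zero] at h0
    have hpk : p ∈ LinearMap.ker (1 - vecMulVec p r).mulVecLin := by
      rw [LinearMap.mem_ker, Matrix.mulVecLin_apply, Matrix.sub_mulVec, Matrix.one_mulVec,
        Matrix.vecMulVec_mulVec, dotProduct_comm, h]
      simp
    rw [h0] at hpk
    exact hp (by simpa using hpk)
  omega

theorem rank_sub_in_in [DecidableEq κ] (hP : Function.Injective P.mulVec)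
    (hQ : Function.Injective fun r => r ᵥ* Q) (p r : κ → F) :
    (P * Q - vecMulVec (P *ᵥ p) (r ᵥ* Q)).rank = (1 - vecMulVec p r).rank := by
  rw [vecMulVec_mulVec_vecMul, ← rank_mul_mul_of_injective _ hP hQ, Matrix.mul_sub, Matrix.sub_mul,
    Matrix.mul_one]

/-- The matrix is P(Q - p vᵀ), and since v is outside the row space of Q, the second factor still
has independent rows. -/
theorem rank_sub_in_out (hP : Function.Injective P.mulVec)
    (hQ : Function.Injective fun r => r ᵥ* Q) (p : κ → F) {v : n → F}
    (hv : ¬∃ r, v = r ᵥ* Q) :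
    (P * Q - vecMulVec (P *ᵥ p) v).rank = Fintype.card κ := by
  rw [← Matrix.mul_vecMulVec, ← Matrix.mul_sub]
  apply rank_mul_of_injective hP
  refine (injective_iff_map_eq_zero (Matrix.vecMulLinear (Q - vecMulVec p v))).2 fun s hs => ?_
  rw [Matrix.vecMulLinear_apply, Matrix.vecMul_sub, Matrix.vecMul_vecMulVec, sub_eq_zero] at hs
  by_cases h0 : s ⬝ᵥ p = 0
  · apply hQ
    simp [hs, h0]
  · refine absurd ⟨(s ⬝ᵥ p)⁻¹ • s, ?_⟩ hv
    rw [Matrix.smul_vecMul, hs, smul_smul, inv_mul_cancel₀ h0, one_smul]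

theorem rank_sub_out_in (hP : Function.Injective P.mulVec)
    (hQ : Function.Injective fun r => r ᵥ* Q) (r : κ → F) {u : m → F}
    (hu : ¬∃ p, u = P *ᵥ p) :
    (P * Q - vecMulVec u (r ᵥ* Q)).rank = Fintype.card κ := by
  rw [← Matrix.rank_transpose, Matrix.transpose_sub, Matrix.transpose_mul,
    Matrix.transpose_vecMulVec, ← Matrix.mulVec_transpose]
  apply rank_sub_in_out
  · intro a b h
    apply hQ
    simpa [Matrix.mulVec_transpose] using h
  · intro a b h
    apply hP
    simpa [Matrix.vecMul_transpose] using h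
  · simpa [Matrix.vecMul_transpose] using hu

/-- The matrix is [P | -u] times Q with v appended as a row; both factors keep full rank, now with
one more inner index. -/
theorem rank_sub_out_out (hP : Function.Injective P.mulVec)
    (hQ : Function.Injective fun r => r ᵥ* Q) {u : m → F} {v : n → F}
    (hu : ¬∃ p, u = P *ᵥ p) (hv : ¬∃ r, v = r ᵥ* Q) :
    (P * Q - vecMulVec u v).rank = Fintype.card κ + 1 := by
  have heq : P * Q - vecMulVec u v =
      fromCols P (replicateCol Unit (-u)) * fromRows Q (replicateRow Unit v) := by
    rw [fromCols_mul_fromRows, ← Matrix.vecMulVec_eq, Matrix.neg_vecMulVec, sub_eq_add_neg]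
  rw [heq, rank_mul_of_injective]
  · simp
  · refine (injective_iff_map_eq_zero (Matrix.mulVecLin _)).2 fun s hs => ?_
    rw [Matrix.mulVecLin_apply, fromCols_mulVec] at hs
    have h1 : replicateCol Unit (-u) *ᵥ (s ∘ Sum.inr) = -(s (Sum.inr ()) • u) := by
      ext i; simp [Matrix.mulVec, dotProduct, mul_comm]
    rw [h1, ← sub_eq_add_neg, sub_eq_zero] at hs
    by_cases h0 : s (Sum.inr ()) = 0
    · rw [h0, zero_smul] at hs
      have h2 : s ∘ Sum.inl = 0 := hP (by rw [hs, Matrix.mulVec_zero])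
      ext (i | i)
      · exact congrFun h2 i
      · exact h0
    · refine absurd ⟨(s (Sum.inr ()))⁻¹ • (s ∘ Sum.inl), ?_⟩ hu
      rw [Matrix.mulVec_smul, hs, smul_smul, inv_mul_cancel₀ h0, one_smul]
  · refine (injective_iff_map_eq_zero (Matrix.vecMulLinear _)).2 fun s hs => ?_
    rw [Matrix.vecMulLinear_apply, vecMul_fromRows] at hs
    have h1 : (s ∘ Sum.inr) ᵥ* replicateRow Unit v = s (Sum.inr ()) • v := by
      ext i; simp [Matrix.vecMul, dotProduct]
    rw [h1] at hs
    by_cases h0 : s (Sum.inr ()) = 0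
    · rw [h0, zero_smul, add_zero] at hs
      have h2 : s ∘ Sum.inl = 0 := hQ (by simp [hs])
      ext (i | i)
      · exact congrFun h2 i
      · exact h0
    · refine absurd ⟨-(s (Sum.inr ()))⁻¹ • (s ∘ Sum.inl), ?_⟩ hv
      rw [Matrix.smul_vecMul, eq_neg_of_add_eq_zero_left hs, smul_neg, neg_smul, neg_neg,
        smul_smul, inv_mul_cancel₀ h0, one_smul]

end Rank

/-! ### Path-length distance equals rank distance -/

section Distance

variable {F : Type*} [Field F] {D N : ℕ}

theorem exists_walk_length_eq_rank (k : ℕ) : ∀ a b : Vertex F D N, (a - b).rank = k →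
    ∃ w : (graph F D N).Walk a b, w.length = k := by
  induction k with
  | zero =>
    intro a b h
    obtain rfl := sub_eq_zero.1 (eq_zero_of_rank_eq_zero h)
    exact ⟨.nil, rfl⟩
  | succ k ih =>
    intro a b h
    obtain ⟨P, Q, hPQ, hP, hQ⟩ := exists_rank_factorization (a - b) h
    -- Any p, r with p·r = 1 would do: subtracting P p rᵀ Q then lowers the rank by exactly one.
    let e : Fin (k + 1) → F := Pi.single 0 1
    have he : e ⬝ᵥ e = 1 := by simp [e]
    have he0 : e ≠ 0 := by
      intro h0; simp [h0] at he
    have hw : (vecMulVec (P *ᵥ e) (e ᵥ* Q)).rank = 1 :=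
      rank_vecMulVec_eq_one (fun h0 => he0 (hP (by simpa using h0)))
        (fun h0 => he0 (hQ (by simpa using h0)))
    have hr := rank_sub_in_in hP hQ e e
    have h1 := rank_one_sub_vecMulVec_add_one he
    rw [Fintype.card_fin] at h1
    rw [← hPQ] at hr
    obtain ⟨w, hwl⟩ := ih (a - vecMulVec (P *ᵥ e) (e ᵥ* Q)) b (by
      rw [sub_right_comm, hr]; omega)
    have hadj : (graph F D N).Adj a (a - vecMulVec (P *ᵥ e) (e ᵥ* Q)) := by
      change (a - (a - _)).rank = 1
      rw [sub_sub_cancel, hw]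
    exact ⟨.cons hadj w, by simp [hwl]⟩

theorem rank_le_walk_length {a b : Vertex F D N} (w : (graph F D N).Walk a b) :
    (a - b).rank ≤ w.length := by
  induction w with
  | nil => simp
  | @cons a c b h w ih =>
    have h1 : (a - c).rank = 1 := h
    have := rank_sub_triangle a c b
    rw [SimpleGraph.Walk.length_cons]
    omega

/-- The path-length distance of the bilinear forms graph is the rank distance. -/
theorem dist_eq_rank (a b : Vertex F D N) : (graph F D N).dist a b = (a - b).rank := by
  obtain ⟨w, hw⟩ := exists_walk_length_eq_rank _ a b rfl
  apply le_antisymm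
  · exact hw ▸ SimpleGraph.dist_le w
  · obtain ⟨w', hw'⟩ := w.reachable.exists_walk_length_eq_dist
    exact hw' ▸ rank_le_walk_length w'

theorem mem_sphere [Fintype F] [DecidableEq F] {i : ℕ} {x z : Vertex F D N} :
    z ∈ sphere (graph F D N) i x ↔ (z - x).rank = i := by
  rw [sphere, Finset.mem_filter, dist_eq_rank, rank_sub_comm]
  simp

end Distance

/-! ### Additive character sums over vectors and over rank one matrices -/

section CharacterSums

variable {F : Type*} [Field F] [Fintype F] [DecidableEq F] {m n κ : Type*} [Fintype m] [Fintype n]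
  [Fintype κ] [DecidableEq m] [DecidableEq n] [DecidableEq κ] {ψ : AddChar F ℂ}

theorem exists_isPrimitive_addChar (F : Type*) [Field F] [Finite F] :
    ∃ ψ : AddChar F ℂ, ψ.IsPrimitive := by
  obtain ⟨a, ha⟩ := exists_ne (0 : F)
  obtain ⟨ψ, hψ⟩ := AddChar.exists_apply_ne_zero.2 ha
  refine ⟨ψ, AddChar.IsPrimitive.of_ne_one ?_⟩
  rintro rfl
  exact hψ rfl

/-- If ψ were a constant c on the nonzero elements, then 1 + (q - 1)c = 0 with |c| = 1, forcing q =
2. -/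
theorem exists_apply_ne_apply (hψ : ψ.IsPrimitive) (hq : Fintype.card F ≠ 2) :
    ∃ s t : F, s ≠ 0 ∧ t ≠ 0 ∧ ψ s ≠ ψ t := by
  by_contra! h
  have h1 : ψ ≠ 1 := by
    intro h1
    apply hψ one_ne_zero
    rw [h1]
    ext
    simp
  have hs := AddChar.sum_eq_zero_of_ne_one h1
  rw [← Finset.add_sum_erase _ _ (Finset.mem_univ 0), AddChar.map_zero_eq_one,
    Finset.sum_congr rfl (g := fun _ => ψ 1)
      (fun t ht => h t 1 (Finset.ne_of_mem_erase ht) one_ne_zero),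
    Finset.sum_const, Finset.card_erase_of_mem (Finset.mem_univ _), Finset.card_univ,
    nsmul_eq_mul] at hs
  have hn : ‖ψ 1‖ = 1 := AddChar.norm_apply _ _
  have h2 : ((Fintype.card F - 1 : ℕ) : ℂ) * ψ 1 = -1 := by linear_combination hs
  have h3 := congrArg norm h2
  rw [norm_mul, hn, norm_neg, norm_one, mul_one, Complex.norm_natCast] at h3
  have h4 : Fintype.card F - 1 = 1 := by exact_mod_cast h3
  omega

theorem sum_apply_linearMap {V : Type*} [AddCommGroup V] [Module F V] [Fintype V]
    (hψ : ψ.IsPrimitive) (f : V →ₗ[F] F) [Decidable (f = 0)] :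
    ∑ v, ψ (f v) = if f = 0 then (Fintype.card V : ℂ) else 0 := by
  classical
  have h := AddChar.sum_eq_ite (ψ.compAddMonoidHom f.toAddMonoidHom)
  have h0 : ψ.compAddMonoidHom f.toAddMonoidHom = 0 ↔ f = 0 := by
    constructor
    · intro h0
      by_contra hf
      obtain ⟨v, hv⟩ : ∃ v, f v ≠ 0 := by
        by_contra! hc
        exact hf (LinearMap.ext hc)
      apply hψ hv
      ext t
      have := DFunLike.congr_fun h0 (t • v)
      simpa [AddChar.mulShift_apply, mul_comm] using this
    · rintro rfl
      ext v
      simp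
  simp only [h0] at h
  exact h

theorem sum_apply_dotProduct (hψ : ψ.IsPrimitive) (w : m → F) :
    ∑ v : m → F, ψ (v ⬝ᵥ w) = if w = 0 then (Fintype.card F : ℂ) ^ Fintype.card m else 0 := by
  have h := sum_apply_linearMap hψ (dotProductBilin F F w)
  have h0 : dotProductBilin F F w = 0 ↔ w = 0 := by
    constructor
    · intro h0
      apply dotProduct_eq
      intro v
      simpa using LinearMap.congr_fun h0 v
    · rintro rfl
      simp
  simp only [h0, Fintype.card_fun, Nat.cast_pow] at h
  rw [← h]
  exact Finset.sum_congr rfl fun v _ => by rw [dotProduct_comm]; rfl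

theorem card_ker_mulVec (C : Matrix m n F) :
    (Finset.univ.filter fun v : n → F => C *ᵥ v = 0).card =
      Fintype.card F ^ (Fintype.card n - C.rank) := by
  classical
  have h1 := LinearMap.finrank_range_add_finrank_ker C.mulVecLin
  rw [← Matrix.rank, Module.finrank_fintype_fun_eq_card] at h1
  have h2 : Fintype.card (LinearMap.ker C.mulVecLin) = _ :=
    Module.card_eq_pow_finrank (K := F) (V := LinearMap.ker C.mulVecLin)
  rw [← h1, Nat.add_sub_cancel_left, ← h2, Fintype.card_subtype]
  simp [LinearMap.mem_ker]

/-- For fixed v the sum over u vanishes unless Cv = 0, so the kernel of C is being counted. -/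
theorem sum_sum_apply_dotProduct_mulVec (hψ : ψ.IsPrimitive) (C : Matrix m n F) :
    ∑ u : m → F, ∑ v : n → F, ψ (u ⬝ᵥ C *ᵥ v) =
      (Fintype.card F : ℂ) ^ Fintype.card m * (Fintype.card F : ℂ) ^ (Fintype.card n - C.rank) := by
  rw [Finset.sum_comm]
  simp_rw [sum_apply_dotProduct hψ]
  rw [← Finset.sum_filter, Finset.sum_const, card_ker_mulVec, nsmul_eq_mul, mul_comm]
  push_cast
  rfl

theorem sum_pairs_ne_zero {M : Type*} [AddCommGroup M] (g : (m → F) → (n → F) → M) :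
    ∑ u : m → F, ∑ v : n → F, (if u ≠ 0 ∧ v ≠ 0 then g u v else 0) =
      ∑ u : m → F, ∑ v : n → F, g u v - ∑ v, g 0 v - ∑ u, g u 0 + g 0 0 := by
  have h : ∀ u v, (if u ≠ 0 ∧ v ≠ 0 then g u v else 0) =
      g u v - (if u = 0 then g u v else 0) - (if v = 0 then g u v else 0)
        + (if u = 0 then (if v = 0 then g u v else 0) else 0) := by
    intro u v
    by_cases hu : u = 0 <;> by_cases hv : v = 0 <;> simp [hu, hv]
  simp_rw [h, Finset.sum_add_distrib, Finset.sum_sub_distrib]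
  have h1 : ∑ u : m → F, ∑ v : n → F, (if u = 0 then g u v else 0) = ∑ v, g 0 v := by
    rw [Finset.sum_comm]
    simp
  have h2 : ∑ u : m → F, ∑ v : n → F, (if u = 0 then (if v = 0 then g u v else 0) else 0)
      = g 0 0 := by
    rw [Finset.sum_comm]
    simp
  rw [h1, h2]
  simp

theorem sum_pairs_apply_dotProduct_mulVec (hψ : ψ.IsPrimitive) (C : Matrix m n F) :
    ∑ u : m → F, ∑ v : n → F, (if u ≠ 0 ∧ v ≠ 0 then ψ (u ⬝ᵥ C *ᵥ v) else 0) =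
      (Fintype.card F : ℂ) ^ Fintype.card m * (Fintype.card F : ℂ) ^ (Fintype.card n - C.rank)
        - (Fintype.card F : ℂ) ^ Fintype.card n - (Fintype.card F : ℂ) ^ Fintype.card m + 1 := by
  rw [sum_pairs_ne_zero (fun u v => ψ (u ⬝ᵥ C *ᵥ v)), sum_sum_apply_dotProduct_mulVec hψ]
  simp

theorem card_pairs_vecMulVec_eq {w : Matrix m n F} (hw : w.rank = 1) :
    (Finset.univ.filter fun p : (m → F) × (n → F) =>
      (p.1 ≠ 0 ∧ p.2 ≠ 0) ∧ vecMulVec p.1 p.2 = w).card = Fintype.card F - 1 := by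
  obtain ⟨u, v, hu, hv, rfl⟩ := rank_eq_one_iff.1 hw
  rw [← Finset.card_univ, ← Finset.card_erase_of_mem (Finset.mem_univ (0 : F))]
  symm
  apply Finset.card_bij (fun c _ => (c • u, c⁻¹ • v))
  · intro c hc
    have hc0 := Finset.ne_of_mem_erase hc
    simp only [Finset.mem_filter, Finset.mem_univ, true_and]
    exact ⟨⟨smul_ne_zero hc0 hu, smul_ne_zero (inv_ne_zero hc0) hv⟩,
      (vecMulVec_eq_vecMulVec_iff hu hv).2 ⟨c, hc0, rfl, rfl⟩⟩
  · intro c _ c' _ h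
    exact smul_left_injective F hu (congrArg Prod.fst h)
  · rintro ⟨u', v'⟩ h
    simp only [Finset.mem_filter, Finset.mem_univ, true_and] at h
    obtain ⟨c, hc, rfl, rfl⟩ := (vecMulVec_eq_vecMulVec_iff hu hv).1 h.2
    exact ⟨c, by simp [hc], rfl⟩

/-- Every rank one matrix arises from `q - 1` pairs of nonzero vectors. -/
theorem sum_pairs_vecMulVec (g : Matrix m n F → ℂ) :
    ∑ u : m → F, ∑ v : n → F, (if u ≠ 0 ∧ v ≠ 0 then g (vecMulVec u v) else 0) =
      ((Fintype.card F : ℂ) - 1) * ∑ w : Matrix m n F, if w.rank = 1 then g w else 0 := by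
  rw [← Fintype.sum_prod_type'
    (f := fun u v => if u ≠ 0 ∧ v ≠ 0 then g (vecMulVec u v) else 0), ← Finset.sum_filter,
    ← Finset.sum_filter, ← Finset.sum_fiberwise_of_maps_to
    (t := Finset.univ.filter fun w : Matrix m n F => w.rank = 1)
    (g := fun p : (m → F) × (n → F) => vecMulVec p.1 p.2), Finset.mul_sum]
  · refine Finset.sum_congr rfl fun w hw => ?_
    rw [Finset.sum_congr rfl (g := fun _ => g w)
      (fun p hp => by rw [(Finset.mem_filter.1 hp).2]), Finset.sum_const, Finset.filter_filter,
      card_pairs_vecMulVec_eq (Finset.mem_filter.1 hw).2, nsmul_eq_mul,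
      Nat.cast_sub Fintype.card_pos, Nat.cast_one]
  · intro p hp
    have hp' := (Finset.mem_filter.1 hp).2
    simp [rank_vecMulVec_eq_one hp'.1 hp'.2]

end CharacterSums

/-! ### The Fourier transform on matrices -/

section Fourier

variable {F : Type*} [Field F] [Fintype F] [DecidableEq F] {m n : Type*} [Fintype m] [Fintype n]
  [DecidableEq m] [DecidableEq n] {ψ : AddChar F ℂ}

/-- The trace form `tr (Cᵀ z)` on matrices. -/
def pairing (C z : Matrix m n F) : F := ∑ i, ∑ j, C i j * z i j

theorem pairing_comm (C z : Matrix m n F) : pairing C z = pairing z C := by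
  simp [pairing, mul_comm]

theorem pairing_add (C z w : Matrix m n F) : pairing C (z + w) = pairing C z + pairing C w := by
  simp [pairing, mul_add, Finset.sum_add_distrib]

theorem pairing_vecMulVec (C : Matrix m n F) (u : m → F) (v : n → F) :
    pairing C (vecMulVec u v) = u ⬝ᵥ C *ᵥ v := by
  simp only [pairing, vecMulVec_apply, dotProduct, Matrix.mulVec, Finset.mul_sum]
  exact Finset.sum_congr rfl fun i _ => Finset.sum_congr rfl fun j _ => by ring

theorem sum_apply_pairing (hψ : ψ.IsPrimitive) (z : Matrix m n F) :
    ∑ C, ψ (pairing C z) = if z = 0 then (Fintype.card (Matrix m n F) : ℂ) else 0 := by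
  let f : Matrix m n F →ₗ[F] F :=
    { toFun := fun C => pairing C z
      map_add' := fun a b => by
        rw [pairing_comm, pairing_add, pairing_comm z a, pairing_comm z b]
      map_smul' := fun c a => by simp [pairing, Finset.mul_sum, mul_assoc] }
  have h := sum_apply_linearMap hψ f
  have h0 : f = 0 ↔ z = 0 := by
    constructor
    · intro h0
      ext i j
      have := LinearMap.congr_fun h0 (Matrix.single i j 1)
      simpa [f, pairing, Matrix.single_apply, ite_and] using this
    · rintro rfl
      ext
      simp [f, pairing]
  simp only [h0] at h
  exact h

/-- The Fourier transform of a real function on matrices. -/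
noncomputable def fourier (ψ : AddChar F ℂ) :
    (Matrix m n F → ℝ) →ₗ[ℝ] Matrix m n F → ℂ where
  toFun w C := ∑ z, (w z : ℂ) * ψ (pairing C z)
  map_add' w w' := by
    ext C
    simp [add_mul, Finset.sum_add_distrib]
  map_smul' c w := by
    ext C
    simp [mul_assoc, Finset.mul_sum]

theorem fourier_apply (w : Matrix m n F → ℝ) (C : Matrix m n F) :
    fourier ψ w C = ∑ z, (w z : ℂ) * ψ (pairing C z) := rfl

theorem fourier_injective (hψ : ψ.IsPrimitive) :
    Function.Injective (fourier ψ : (Matrix m n F → ℝ) →ₗ[ℝ] Matrix m n F → ℂ) := by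
  refine (injective_iff_map_eq_zero _).2 fun w hw => ?_
  ext z
  have h1 : ∑ C, fourier ψ w C * ψ (pairing C (-z)) =
      (w z : ℂ) * Fintype.card (Matrix m n F) := by
    simp_rw [fourier_apply, Finset.sum_mul]
    rw [Finset.sum_comm]
    simp_rw [mul_assoc, ← AddChar.map_add_eq_mul, ← pairing_add, ← Finset.mul_sum,
      sum_apply_pairing hψ, ← sub_eq_add_neg, sub_eq_zero]
    simp
  simp only [hw, Pi.zero_apply, zero_mul, Finset.sum_const_zero] at h1
  have h2 : (Fintype.card (Matrix m n F) : ℂ) ≠ 0 := Nat.cast_ne_zero.2 Fintype.card_ne_zero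
  have h3 := (mul_eq_zero.1 h1.symm).resolve_right h2
  exact_mod_cast h3

end Fourier

/-! ### Spectrum of the graph and Fourier description of E -/

section Spectrum

/-- The eigenvalue of the bilinear forms graph that belongs to the characters of rank `r`. -/
noncomputable def eigval (q D M r : ℕ) : ℝ :=
  ((q : ℝ) ^ D * (q : ℝ) ^ (M - r) - (q : ℝ) ^ M - (q : ℝ) ^ D + 1) / ((q : ℝ) - 1)

/-- The bound `s ≤ M` matters: beyond it `M - s` truncates and the values become constant. -/
theorem eigval_strictAntiOn {q : ℕ} (hq : 1 < q) (D M : ℕ) {r s : ℕ} (hrs : r < s) (hs : s ≤ M) :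
    eigval q D M s < eigval q D M r := by
  have hq' : (1 : ℝ) < q := by exact_mod_cast hq
  unfold eigval
  have h1 : (q : ℝ) ^ (M - s) < (q : ℝ) ^ (M - r) := pow_lt_pow_right₀ hq' (by omega)
  have h2 : (0 : ℝ) < (q : ℝ) ^ D := by positivity
  have h3 : (0 : ℝ) < (q : ℝ) - 1 := by linarith
  gcongr

variable {F : Type*} [Field F] [Fintype F] [DecidableEq F] {D N : ℕ} {ψ : AddChar F ℂ}

theorem card_sub_one_ne_zero : ((Fintype.card F : ℂ) - 1) ≠ 0 := by
  have : Fintype.card F ≠ 1 := Fintype.one_lt_card.ne'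
  rw [sub_ne_zero]
  exact_mod_cast this

theorem sum_rank_one_apply_pairing (hψ : ψ.IsPrimitive) (C : Vertex F D N) :
    (∑ w : Vertex F D N, if w.rank = 1 then ψ (pairing C w) else 0) =
      (eigval (Fintype.card F) D (N - D) C.rank : ℂ) := by
  have h := sum_pairs_vecMulVec fun w : Vertex F D N => ψ (pairing C w)
  simp_rw [pairing_vecMulVec] at h
  rw [sum_pairs_apply_dotProduct_mulVec hψ, Fintype.card_fin, Fintype.card_fin] at h
  rw [eigval]
  push_cast
  rw [eq_div_iff card_sub_one_ne_zero, h, mul_comm]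

theorem adj_mulVec_apply (v : Vertex F D N → ℝ) (z : Vertex F D N) :
    (adj (graph F D N) *ᵥ v) z = ∑ w : Vertex F D N, if w.rank = 1 then v (z + w) else 0 := by
  rw [Matrix.mulVec, dotProduct, ← Equiv.sum_comp (Equiv.addLeft z)]
  refine Finset.sum_congr rfl fun w _ => ?_
  have h : (graph F D N).Adj z (z + w) ↔ w.rank = 1 := by
    change (z - (z + w)).rank = 1 ↔ _
    rw [sub_add_cancel_left, rank_neg]
  simp [adj, SimpleGraph.adjMatrix_apply, h]

/-- The adjacency matrix acts as convolution with the indicator of the rank one matrices, a set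
closed under negation. -/
theorem fourier_adj_mulVec (hψ : ψ.IsPrimitive) (v : Vertex F D N → ℝ) (C : Vertex F D N) :
    fourier ψ (adj (graph F D N) *ᵥ v) C =
      (eigval (Fintype.card F) D (N - D) C.rank : ℂ) * fourier ψ v C := by
  simp_rw [fourier_apply, adj_mulVec_apply]
  push_cast
  simp_rw [Finset.sum_mul]
  rw [Finset.sum_comm, ← sum_rank_one_apply_pairing hψ, ← Equiv.sum_comp (Equiv.neg _),
    Finset.sum_mul]
  refine Finset.sum_congr rfl fun w _ => ?_
  rw [Equiv.neg_apply, rank_neg]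
  by_cases hw : w.rank = 1
  · simp only [hw, if_true]
    rw [← Equiv.sum_comp (Equiv.addRight w), Finset.mul_sum]
    refine Finset.sum_congr rfl fun z _ => ?_
    rw [Equiv.coe_addRight, add_neg_cancel_right, pairing_add, AddChar.map_add_eq_mul]
    ring
  · simp [hw]

theorem eigenvalue_of_fourier_ne_zero (hψ : ψ.IsPrimitive) {v : Vertex F D N → ℝ} {θ : ℝ}
    (hv : adj (graph F D N) *ᵥ v = θ • v) {C : Vertex F D N} (hC : fourier ψ v C ≠ 0) :
    θ = eigval (Fintype.card F) D (N - D) C.rank := by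
  have h := fourier_adj_mulVec hψ v C
  rw [hv, map_smul, Pi.smul_apply, Complex.real_smul] at h
  exact_mod_cast mul_right_cancel₀ hC h

theorem eigenvalues_adj_graph (F : Type*) [Field F] [Fintype F] [DecidableEq F] (D N : ℕ) :
    eigenvalues (adj (graph F D N)) =
      Set.range fun C : Vertex F D N => eigval (Fintype.card F) D (N - D) C.rank := by
  obtain ⟨ψ, hψ⟩ := exists_isPrimitive_addChar F
  ext θ
  constructor
  · rintro ⟨v, hv0, hv⟩
    have : fourier ψ v ≠ 0 := fun h => hv0 (fourier_injective hψ (by rw [h, map_zero]))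
    obtain ⟨C, hC⟩ := Function.ne_iff.1 this
    exact ⟨C, (eigenvalue_of_fourier_ne_zero hψ hv hC).symm⟩
  · rintro ⟨C, rfl⟩
    -- The character of C is a complex eigenvector with real eigenvalue, so its real part is an
    -- eigenvector too; it takes the value 1 at 0.
    refine ⟨fun z => (ψ (pairing C z)).re, fun h => ?_, ?_⟩
    · have := congrFun h 0
      simp [pairing] at this
    · ext z
      rw [adj_mulVec_apply, Pi.smul_apply, smul_eq_mul, ← Complex.re_ofReal_mul,
        ← sum_rank_one_apply_pairing hψ, Finset.sum_mul, Complex.re_sum]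
      refine Finset.sum_congr rfl fun w _ => ?_
      by_cases hw : w.rank = 1
      · simp only [hw, if_true]
        rw [pairing_add, AddChar.map_add_eq_mul, mul_comm]
      · simp [hw]

theorem secondLargestEigenvalue_adj_graph (hD : 0 < D) (hN : 0 < N - D) :
    secondLargestEigenvalue (adj (graph F D N)) = eigval (Fintype.card F) D (N - D) 1 := by
  have hq : 1 < Fintype.card F := Fintype.one_lt_card
  have h0 : sSup (eigenvalues (adj (graph F D N))) = eigval (Fintype.card F) D (N - D) 0 := by
    apply IsGreatest.csSup_eq
    rw [eigenvalues_adj_graph]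
    refine ⟨⟨0, by simp⟩, ?_⟩
    rintro _ ⟨C, rfl⟩
    rcases Nat.eq_zero_or_pos C.rank with h | h
    · exact (congrArg _ h).le
    · exact (eigval_strictAntiOn hq D _ h C.rank_le_width).le
  rw [secondLargestEigenvalue, h0]
  apply IsGreatest.csSup_eq
  rw [eigenvalues_adj_graph]
  have hlt := eigval_strictAntiOn hq D (N - D) zero_lt_one hN
  refine ⟨⟨⟨vecMulVec (Pi.single ⟨0, hD⟩ 1) (Pi.single ⟨0, hN⟩ 1), ?_⟩, hlt.ne⟩, ?_⟩
  · exact congrArg _ (rank_vecMulVec_eq_one (by simp) (by simp))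
  · rintro _ ⟨⟨C, rfl⟩, hC⟩
    rcases Nat.lt_trichotomy C.rank 1 with h | h | h
    · exact absurd (congrArg _ (Nat.lt_one_iff.1 h)) hC
    · exact (congrArg _ h).le
    · exact (eigval_strictAntiOn hq D _ h C.rank_le_width).le

theorem isSymm_adj {X : Type*} (G : SimpleGraph X) : (adj G).IsSymm := by
  classical
  rw [adj]
  exact SimpleGraph.isSymm_adjMatrix G

theorem linearMap_ext_of_eigenvectors {X M : Type*} [Fintype X] [DecidableEq X] [AddCommGroup M]
    [Module ℝ M] {B : Matrix X X ℝ} (hB : B.IsSymm) {f g : (X → ℝ) →ₗ[ℝ] M}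
    (h : ∀ (θ : ℝ) (v : X → ℝ), B *ᵥ v = θ • v → f v = g v) : f = g := by
  have hH : B.IsHermitian := by
    rw [Matrix.IsHermitian, Matrix.conjTranspose_eq_transpose_of_trivial]; exact hB
  apply (hH.eigenvectorBasis.toBasis.map (WithLp.linearEquiv 2 ℝ (X → ℝ))).ext
  intro j
  apply h (hH.eigenvalues j)
  simpa using hH.mulVec_eigenvectorBasis j

/-- On the Fourier side, `E` is the restriction to the matrices of rank one. -/
theorem fourier_idem_mulVec (hψ : ψ.IsPrimitive) (hD : 0 < D) (hN : 0 < N - D)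
    (v : Vertex F D N → ℝ) (C : Vertex F D N) :
    fourier ψ (idem F D N *ᵥ v) C = if C.rank = 1 then fourier ψ v C else 0 := by
  have hE := (eq_primitiveIdempotent_iff (isSymm_adj (graph F D N))
    (secondLargestEigenvalue (adj (graph F D N))) (idem F D N)).1 rfl
  rw [secondLargestEigenvalue_adj_graph hD hN] at hE
  have key : LinearMap.proj C ∘ₗ fourier ψ ∘ₗ (idem F D N).mulVecLin =
      (if C.rank = 1 then LinearMap.proj C ∘ₗ fourier ψ else 0 :
        (Vertex F D N → ℝ) →ₗ[ℝ] ℂ) := by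
    -- By the spectral theorem it is enough to test θ-eigenvectors. Their transform lives on those C
    -- whose eigenvalue is θ, and by strict monotonicity in the rank, θ = θ_1 there exactly when C
    -- has rank one.
    apply linearMap_ext_of_eigenvectors (isSymm_adj (graph F D N))
    intro θ v hv
    by_cases hC : fourier ψ v C = 0
    · by_cases hθ : θ = eigval (Fintype.card F) D (N - D) 1
      · rw [hθ] at hv
        simp only [LinearMap.comp_apply, Matrix.mulVecLin_apply, hE.1 v hv]
        split_ifs <;> simp [hC]
      · simp only [LinearMap.comp_apply, Matrix.mulVecLin_apply, hE.2 θ v hθ hv]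
        split_ifs <;> simp [hC]
    · have hθ := eigenvalue_of_fourier_ne_zero hψ hv hC
      by_cases h1 : C.rank = 1
      · rw [h1] at hθ
        rw [hθ] at hv
        simp [hE.1 v hv, h1]
      · have hne : θ ≠ eigval (Fintype.card F) D (N - D) 1 := by
          rw [hθ]
          rcases Nat.lt_or_gt_of_ne h1 with h | h
          · exact (eigval_strictAntiOn Fintype.one_lt_card D _ h hN).ne'
          · exact (eigval_strictAntiOn Fintype.one_lt_card D _ h C.rank_le_width).ne
        simp [hE.2 θ v hne hv, h1]
  have := LinearMap.congr_fun key v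
  rw [LinearMap.comp_apply, LinearMap.comp_apply, Matrix.mulVecLin_apply, LinearMap.proj_apply]
    at this
  rw [this]
  split_ifs <;> rfl

end Spectrum

/-! ### The six positions of a rank one matrix relative to PQ -/

section Kind

variable {F : Type*} [Field F] {m n κ : Type*} [Fintype m] [Fintype n] [Fintype κ]

/-- The position of a pair `(u, v)` relative to the matrix `P * Q`, for `P` with independent columns
and `Q` with independent rows. -/
def kind (P : Matrix m κ F) (Q : Matrix κ n F) : Fin 6 → (m → F) → (n → F) → Prop :=
  ![fun u v => ∃ p r, u = P *ᵥ p ∧ v = r ᵥ* Q ∧ p ⬝ᵥ r = 1,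
    fun u v => ∃ p r, u = P *ᵥ p ∧ v = r ᵥ* Q ∧ p ⬝ᵥ r = 0,
    fun u v => ∃ p r, u = P *ᵥ p ∧ v = r ᵥ* Q ∧ p ⬝ᵥ r ≠ 0 ∧ p ⬝ᵥ r ≠ 1,
    fun u v => (∃ p, u = P *ᵥ p) ∧ ¬∃ r, v = r ᵥ* Q,
    fun u v => (¬∃ p, u = P *ᵥ p) ∧ ∃ r, v = r ᵥ* Q,
    fun u v => (¬∃ p, u = P *ᵥ p) ∧ ¬∃ r, v = r ᵥ* Q]

variable {P : Matrix m κ F} {Q : Matrix κ n F}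

theorem exists_kind (P : Matrix m κ F) (Q : Matrix κ n F) (u : m → F) (v : n → F) :
    ∃ i, kind P Q i u v := by
  by_cases hu : ∃ p, u = P *ᵥ p <;> by_cases hv : ∃ r, v = r ᵥ* Q
  · obtain ⟨p, rfl⟩ := hu
    obtain ⟨r, rfl⟩ := hv
    by_cases h1 : p ⬝ᵥ r = 1
    · exact ⟨0, p, r, rfl, rfl, h1⟩
    by_cases h0 : p ⬝ᵥ r = 0
    · exact ⟨1, p, r, rfl, rfl, h0⟩
    · exact ⟨2, p, r, rfl, rfl, h0, h1⟩
  · exact ⟨3, hu, hv⟩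
  · exact ⟨4, hu, hv⟩
  · exact ⟨5, hu, hv⟩

theorem rank_sub_add_one_eq_iff [DecidableEq κ] (hP : Function.Injective P.mulVec)
    (hQ : Function.Injective fun r => r ᵥ* Q) (u : m → F) (v : n → F) :
    (P * Q - vecMulVec u v).rank + 1 = Fintype.card κ ↔ kind P Q 0 u v := by
  constructor
  · intro h
    by_cases hu : ∃ p, u = P *ᵥ p <;> by_cases hv : ∃ r, v = r ᵥ* Q
    · obtain ⟨p, rfl⟩ := hu
      obtain ⟨r, rfl⟩ := hv
      refine ⟨p, r, rfl, rfl, ?_⟩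
      by_contra hne
      rw [rank_sub_in_in hP hQ, rank_one_sub_vecMulVec hne] at h
      omega
    · obtain ⟨p, rfl⟩ := hu
      rw [rank_sub_in_out hP hQ p hv] at h
      omega
    · obtain ⟨r, rfl⟩ := hv
      rw [rank_sub_out_in hP hQ r hu] at h
      omega
    · rw [rank_sub_out_out hP hQ hu hv] at h
      omega
  · rintro ⟨p, r, rfl, rfl, h⟩
    rw [rank_sub_in_in hP hQ, rank_one_sub_vecMulVec_add_one h]

theorem rank_sub_eq_add_one_iff [DecidableEq κ] (hP : Function.Injective P.mulVec)
    (hQ : Function.Injective fun r => r ᵥ* Q) (u : m → F) (v : n → F) :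
    (P * Q - vecMulVec u v).rank = Fintype.card κ + 1 ↔ kind P Q 5 u v := by
  constructor
  · intro h
    by_cases hu : ∃ p, u = P *ᵥ p <;> by_cases hv : ∃ r, v = r ᵥ* Q
    · obtain ⟨p, rfl⟩ := hu
      obtain ⟨r, rfl⟩ := hv
      rw [rank_sub_in_in hP hQ] at h
      have := Matrix.rank_le_card_width (1 - vecMulVec p r)
      omega
    · obtain ⟨p, rfl⟩ := hu
      rw [rank_sub_in_out hP hQ p hv] at h
      omega
    · obtain ⟨r, rfl⟩ := hv
      rw [rank_sub_out_in hP hQ r hu] at h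
      omega
    · exact ⟨hu, hv⟩
  · rintro ⟨hu, hv⟩
    exact rank_sub_out_out hP hQ hu hv

theorem rank_sub_eq_card_of_kind [DecidableEq κ] (hP : Function.Injective P.mulVec)
    (hQ : Function.Injective fun r => r ᵥ* Q) {u : m → F} {v : n → F}
    (h : kind P Q 1 u v ∨ kind P Q 2 u v ∨ kind P Q 3 u v ∨ kind P Q 4 u v) :
    (P * Q - vecMulVec u v).rank = Fintype.card κ := by
  rcases h with ⟨p, r, rfl, rfl, h⟩ | ⟨p, r, rfl, rfl, -, h⟩ | ⟨⟨p, rfl⟩, h⟩ | ⟨h, ⟨r, rfl⟩⟩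
  · rw [rank_sub_in_in hP hQ, rank_one_sub_vecMulVec (by simp [h])]
  · rw [rank_sub_in_in hP hQ, rank_one_sub_vecMulVec h]
  · exact rank_sub_in_out hP hQ p h
  · exact rank_sub_out_in hP hQ r h

theorem replicateCol_mulVec (a : m → F) (s : Unit → F) : replicateCol Unit a *ᵥ s = s () • a := by
  ext i
  simp [Matrix.mulVec, dotProduct, mul_comm]

theorem vecMul_replicateRow (b : n → F) (s : Unit → F) : s ᵥ* replicateRow Unit b = s () • b := by
  ext i
  simp [Matrix.vecMul, dotProduct]

/-- A rank one matrix at distance one from `u vᵀ` shares its column space or its row space. -/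
theorem eq_vecMulVec_of_rank_sub_eq_one {u : m → F} {v : n → F} (hu : u ≠ 0) (hv : v ≠ 0)
    {w : Matrix m n F} (hw : w.rank = 1) (h : (w - vecMulVec u v).rank = 1) :
    (∃ v', w = vecMulVec u v') ∨ ∃ u', w = vecMulVec u' v := by
  obtain ⟨a, b, ha, hb, rfl⟩ := rank_eq_one_iff.1 hw
  have hP : Function.Injective (replicateCol Unit a).mulVec := by
    refine (injective_iff_map_eq_zero (Matrix.mulVecLin _)).2 fun s hs => ?_
    rw [Matrix.mulVecLin_apply, replicateCol_mulVec, smul_eq_zero] at hs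
    ext
    exact hs.resolve_right ha
  have hQ : Function.Injective fun r => r ᵥ* replicateRow Unit b := by
    refine (injective_iff_map_eq_zero (Matrix.vecMulLinear _)).2 fun s hs => ?_
    rw [Matrix.vecMulLinear_apply, vecMul_replicateRow, smul_eq_zero] at hs
    ext
    exact hs.resolve_right hb
  by_cases hu' : ∃ p, u = replicateCol Unit a *ᵥ p
  · obtain ⟨p, rfl⟩ := hu'
    rw [replicateCol_mulVec] at hu ⊢
    have h0 : p () ≠ 0 := fun h0 => hu (by rw [h0, zero_smul])
    refine .inl ⟨(p ())⁻¹ • b, ?_⟩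
    exact (vecMulVec_eq_vecMulVec_iff hu (smul_ne_zero (inv_ne_zero h0) hb)).2
      ⟨(p ())⁻¹, inv_ne_zero h0, by rw [smul_smul, inv_mul_cancel₀ h0, one_smul],
        by rw [inv_inv, smul_smul, mul_inv_cancel₀ h0, one_smul]⟩
  by_cases hv' : ∃ r, v = r ᵥ* replicateRow Unit b
  · obtain ⟨r, rfl⟩ := hv'
    rw [vecMul_replicateRow] at hv ⊢
    have h0 : r () ≠ 0 := fun h0 => hv (by rw [h0, zero_smul])
    refine .inr ⟨(r ())⁻¹ • a, ?_⟩
    exact (vecMulVec_eq_vecMulVec_iff (smul_ne_zero (inv_ne_zero h0) ha) hv).2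
      ⟨r (), h0, by rw [smul_smul, mul_inv_cancel₀ h0, one_smul],
        by rw [smul_smul, inv_mul_cancel₀ h0, one_smul]⟩
  · have := rank_sub_out_out hP hQ hu' hv'
    rw [← Matrix.vecMulVec_eq, h] at this
    simp at this

end Kind

/-! ### Counting common neighbours in Γ(x) -/

section Counting

variable {F : Type*} [Field F] [Fintype F] [DecidableEq F] {m n κ : Type*} [Fintype m] [Fintype n]
  [Fintype κ] [DecidableEq m] [DecidableEq n] [DecidableEq κ] {P : Matrix m κ F} {Q : Matrix κ n F}

theorem card_dotProduct_eq {p : κ → F} (hp : p ≠ 0) (c : F) :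
    (Finset.univ.filter fun r : κ → F => p ⬝ᵥ r = c).card =
      Fintype.card F ^ (Fintype.card κ - 1) := by
  obtain ⟨i, hi⟩ := Function.ne_iff.1 hp
  have h0 : (Finset.univ.filter fun r : κ → F => p ⬝ᵥ r = 0).card =
      Fintype.card F ^ (Fintype.card κ - 1) := by
    have hr : (replicateRow Unit p).rank = 1 := by
      have h := rank_vecMulVec_eq_one (u := fun _ : Unit => (1 : F)) (v := p)
        (Function.ne_iff.2 ⟨(), one_ne_zero⟩) hp
      have h1 : vecMulVec (fun _ : Unit => (1 : F)) p = replicateRow Unit p := by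
        ext; simp [vecMulVec_apply]
      rwa [h1] at h
    rw [← hr, ← card_ker_mulVec]
    congr 1
    ext r
    simp [funext_iff, Matrix.mulVec]
  rw [← h0]
  symm
  apply Finset.card_equiv (Equiv.addRight (Pi.single i (c / p i)))
  intro r
  have : p ⬝ᵥ Pi.single i (c / p i) = c := by
    rw [dotProduct_single, mul_div_cancel₀ _ hi]
  simp [dotProduct_add, this]

theorem card_kind_zero_of_mulVec (hP : Function.Injective P.mulVec)
    (hQ : Function.Injective fun r => r ᵥ* Q) {p : κ → F} (hp : p ≠ 0) :
    (Finset.univ.filter fun v => v ≠ 0 ∧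
      (P * Q - vecMulVec (P *ᵥ p) v).rank + 1 = Fintype.card κ).card =
      Fintype.card F ^ (Fintype.card κ - 1) := by
  rw [← card_dotProduct_eq hp 1]
  symm
  apply Finset.card_bij (fun r _ => r ᵥ* Q)
  · intro r hr
    have hr' := (Finset.mem_filter.1 hr).2
    rw [Finset.mem_filter, rank_sub_add_one_eq_iff hP hQ]
    refine ⟨Finset.mem_univ _, fun h0 => ?_, p, r, rfl, rfl, hr'⟩
    have : r = 0 := hQ (by simpa using h0)
    simp [this] at hr'
  · intro r _ s _ h
    exact hQ h
  · intro v hv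
    rw [Finset.mem_filter, rank_sub_add_one_eq_iff hP hQ] at hv
    obtain ⟨-, -, p', r, h, rfl, hpr⟩ := hv
    obtain rfl := hP h
    exact ⟨r, by simpa using hpr, rfl⟩

theorem card_kind_zero_of_not_mulVec (hP : Function.Injective P.mulVec)
    (hQ : Function.Injective fun r => r ᵥ* Q) {u : m → F} (hu : ¬∃ p, u = P *ᵥ p) :
    (Finset.univ.filter fun v => v ≠ 0 ∧
      (P * Q - vecMulVec u v).rank + 1 = Fintype.card κ).card = 0 := by
  rw [Finset.card_eq_zero, Finset.filter_eq_empty_iff]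
  rintro v - ⟨-, hv⟩
  rw [rank_sub_add_one_eq_iff hP hQ] at hv
  obtain ⟨p, r, rfl, -⟩ := hv
  exact hu ⟨p, rfl⟩

theorem card_kind_five_of_mulVec (hP : Function.Injective P.mulVec)
    (hQ : Function.Injective fun r => r ᵥ* Q) (p : κ → F) :
    (Finset.univ.filter fun v => v ≠ 0 ∧
      (P * Q - vecMulVec (P *ᵥ p) v).rank = Fintype.card κ + 1).card = 0 := by
  rw [Finset.card_eq_zero, Finset.filter_eq_empty_iff]
  rintro v - ⟨-, hv⟩
  rw [rank_sub_eq_add_one_iff hP hQ] at hv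
  exact hv.1 ⟨p, rfl⟩

theorem card_kind_five_of_not_mulVec (hP : Function.Injective P.mulVec)
    (hQ : Function.Injective fun r => r ᵥ* Q) {u : m → F} (hu : ¬∃ p, u = P *ᵥ p) :
    (Finset.univ.filter fun v => v ≠ 0 ∧
      (P * Q - vecMulVec u v).rank = Fintype.card κ + 1).card =
      Fintype.card F ^ Fintype.card n - Fintype.card F ^ Fintype.card κ := by
  have h : (Finset.univ.filter fun v => v ≠ 0 ∧
      (P * Q - vecMulVec u v).rank = Fintype.card κ + 1) =
      (Finset.univ.image fun r => r ᵥ* Q)ᶜ := by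
    ext v
    rw [Finset.mem_filter, rank_sub_eq_add_one_iff hP hQ]
    simp only [Finset.mem_univ, true_and, Finset.mem_compl, Finset.mem_image]
    constructor
    · rintro ⟨-, -, h⟩ ⟨r, rfl⟩
      exact h ⟨r, rfl⟩
    · intro h
      refine ⟨?_, hu, ?_⟩
      · rintro rfl
        exact h ⟨0, by simp⟩
      · rintro ⟨r, rfl⟩
        exact h ⟨r, rfl⟩
  rw [h, Finset.card_compl, Finset.card_image_of_injective _ hQ]
  simp

theorem injective_transpose_mulVec (hQ : Function.Injective fun r => r ᵥ* Q) :
    Function.Injective Qᵀ.mulVec := by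
  intro a b h
  apply hQ
  simpa [Matrix.mulVec_transpose] using h

theorem injective_vecMul_transpose (hP : Function.Injective P.mulVec) :
    Function.Injective fun r => r ᵥ* Pᵀ := by
  intro a b h
  apply hP
  simpa [Matrix.vecMul_transpose] using h

theorem rank_transpose_sub_vecMulVec (u : m → F) (v : n → F) :
    (Qᵀ * Pᵀ - vecMulVec v u).rank = (P * Q - vecMulVec u v).rank := by
  rw [← Matrix.rank_transpose (P * Q - _), Matrix.transpose_sub, Matrix.transpose_mul,
    Matrix.transpose_vecMulVec]

theorem card_kind_zero_of_vecMul (hP : Function.Injective P.mulVec)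
    (hQ : Function.Injective fun r => r ᵥ* Q) {r : κ → F} (hr : r ≠ 0) :
    (Finset.univ.filter fun u => u ≠ 0 ∧
      (P * Q - vecMulVec u (r ᵥ* Q)).rank + 1 = Fintype.card κ).card =
      Fintype.card F ^ (Fintype.card κ - 1) := by
  have h := card_kind_zero_of_mulVec (injective_transpose_mulVec hQ)
    (injective_vecMul_transpose hP) hr
  simpa only [rank_transpose_sub_vecMulVec, Matrix.mulVec_transpose] using h

theorem card_kind_zero_of_not_vecMul (hP : Function.Injective P.mulVec)
    (hQ : Function.Injective fun r => r ᵥ* Q) {v : n → F} (hv : ¬∃ r, v = r ᵥ* Q) :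
    (Finset.univ.filter fun u => u ≠ 0 ∧
      (P * Q - vecMulVec u v).rank + 1 = Fintype.card κ).card = 0 := by
  have h := card_kind_zero_of_not_mulVec (injective_transpose_mulVec hQ)
    (injective_vecMul_transpose hP) (u := v) (by simpa only [Matrix.mulVec_transpose] using hv)
  simpa only [rank_transpose_sub_vecMulVec, Matrix.mulVec_transpose] using h

theorem card_kind_five_of_vecMul (hP : Function.Injective P.mulVec)
    (hQ : Function.Injective fun r => r ᵥ* Q) (r : κ → F) :
    (Finset.univ.filter fun u => u ≠ 0 ∧
      (P * Q - vecMulVec u (r ᵥ* Q)).rank = Fintype.card κ + 1).card = 0 := by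
  have h := card_kind_five_of_mulVec (injective_transpose_mulVec hQ)
    (injective_vecMul_transpose hP) r
  simpa only [rank_transpose_sub_vecMulVec, Matrix.mulVec_transpose] using h

theorem card_kind_five_of_not_vecMul (hP : Function.Injective P.mulVec)
    (hQ : Function.Injective fun r => r ᵥ* Q) {v : n → F} (hv : ¬∃ r, v = r ᵥ* Q) :
    (Finset.univ.filter fun u => u ≠ 0 ∧
      (P * Q - vecMulVec u v).rank = Fintype.card κ + 1).card =
      Fintype.card F ^ Fintype.card m - Fintype.card F ^ Fintype.card κ := by
  have h := card_kind_five_of_not_mulVec (injective_transpose_mulVec hQ)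
    (injective_vecMul_transpose hP) (u := v) (by simpa only [Matrix.mulVec_transpose] using hv)
  simpa only [rank_transpose_sub_vecMulVec, Matrix.mulVec_transpose] using h

theorem vecMulVec_right_injective {u : m → F} (hu : u ≠ 0) :
    Function.Injective fun v : n → F => vecMulVec u v := by
  intro v v' h
  have : vecMulVec u (v - v') = 0 := by rw [vecMulVec_sub]; exact sub_eq_zero.2 h
  exact sub_eq_zero.1 ((vecMulVec_eq_zero_iff.1 this).resolve_left hu)

theorem vecMulVec_left_injective {v : n → F} (hv : v ≠ 0) :
    Function.Injective fun u : m → F => vecMulVec u v := by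
  intro u u' h
  have : vecMulVec (u - u') v = 0 := by rw [sub_vecMulVec]; exact sub_eq_zero.2 h
  exact sub_eq_zero.1 ((vecMulVec_eq_zero_iff.1 this).resolve_right hv)

theorem rank_vecMulVec_sub_eq_one_right {u : m → F} {v v' : n → F} (hu : u ≠ 0) (h : v' ≠ v) :
    (vecMulVec u v' - vecMulVec u v).rank = 1 := by
  rw [← vecMulVec_sub]
  exact rank_vecMulVec_eq_one hu (sub_ne_zero.2 h)

theorem rank_vecMulVec_sub_eq_one_left {u u' : m → F} {v : n → F} (hv : v ≠ 0) (h : u' ≠ u) :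
    (vecMulVec u' v - vecMulVec u v).rank = 1 := by
  rw [← sub_vecMulVec]
  exact rank_vecMulVec_eq_one (sub_ne_zero.2 h) hv

/-- The number of common neighbours, subject to a condition, of `0` and `u vᵀ`. -/
theorem card_common_neighbours {u : m → F} {v : n → F} (hu : u ≠ 0) (hv : v ≠ 0)
    (p : Matrix m n F → Prop) [DecidablePred p] (hp : ¬p (vecMulVec u v)) :
    (Finset.univ.filter fun w : Matrix m n F =>
        w.rank = 1 ∧ (w - vecMulVec u v).rank = 1 ∧ p w).card +
      (Finset.univ.filter fun c : F => c ≠ 0 ∧ p (vecMulVec (c • u) v)).card =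
    (Finset.univ.filter fun v' => v' ≠ 0 ∧ p (vecMulVec u v')).card +
      (Finset.univ.filter fun u' => u' ≠ 0 ∧ p (vecMulVec u' v)).card := by
  -- Inclusion-exclusion for the matrices u v'ᵀ and u' vᵀ, which overlap in the nonzero multiples of
  -- u vᵀ. As `p` fails at u vᵀ itself, that matrix, which is not its own neighbour, drops out.
  rw [← Finset.card_image_of_injective _ (vecMulVec_right_injective (n := n) hu),
    ← Finset.card_image_of_injective _ (vecMulVec_left_injective (m := m) hv),
    ← Finset.card_image_of_injective _ ((vecMulVec_left_injective hv).comp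
      (smul_left_injective F hu))]
  refine Eq.trans ?_ (Finset.card_union_add_card_inter _ _)
  congr 2
  · ext w
    simp only [Finset.mem_filter, Finset.mem_univ, true_and, Finset.mem_union, Finset.mem_image]
    constructor
    · rintro ⟨h1, h2, h3⟩
      rcases eq_vecMulVec_of_rank_sub_eq_one hu hv h1 h2 with ⟨v', rfl⟩ | ⟨u', rfl⟩
      · refine .inl ⟨v', ⟨?_, h3⟩, rfl⟩
        rintro rfl
        simp [vecMulVec_eq_zero_iff.2] at h1
      · refine .inr ⟨u', ⟨?_, h3⟩, rfl⟩
        rintro rfl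
        simp [vecMulVec_eq_zero_iff.2] at h1
    · rintro (⟨v', ⟨h0, h⟩, rfl⟩ | ⟨u', ⟨h0, h⟩, rfl⟩)
      · refine ⟨rank_vecMulVec_eq_one hu h0, rank_vecMulVec_sub_eq_one_right hu ?_, h⟩
        rintro rfl
        exact hp h
      · refine ⟨rank_vecMulVec_eq_one h0 hv, rank_vecMulVec_sub_eq_one_left hv ?_, h⟩
        rintro rfl
        exact hp h
  · ext w
    simp only [Finset.mem_filter, Finset.mem_univ, true_and, Finset.mem_inter, Finset.mem_image,
      Function.comp_apply]
    constructor
    · rintro ⟨c, ⟨hc, h⟩, rfl⟩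
      refine ⟨⟨c • v, ⟨smul_ne_zero hc hv, ?_⟩, ?_⟩, ⟨c • u, ⟨smul_ne_zero hc hu, h⟩, rfl⟩⟩
      · rwa [vecMulVec_smul, ← smul_vecMulVec]
      · rw [vecMulVec_smul, ← smul_vecMulVec]
    · rintro ⟨⟨v', ⟨h0, h⟩, rfl⟩, ⟨u', ⟨h0', h'⟩, he⟩⟩
      obtain ⟨c, hc, rfl, hv'⟩ := (vecMulVec_eq_vecMulVec_iff hu h0).1 he
      exact ⟨c, ⟨hc, h'⟩, he⟩

/-- Scaling turns p·r into c(p·r), which equals 1 for a single c if p·r ≠ 0 and for none otherwise.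
This is the source of the -1 that separates O_3 from O_2. -/
theorem card_smul_kind_zero (hP : Function.Injective P.mulVec)
    (hQ : Function.Injective fun r => r ᵥ* Q) (p r : κ → F) :
    (Finset.univ.filter fun c : F => c ≠ 0 ∧
      (P * Q - vecMulVec (c • P *ᵥ p) (r ᵥ* Q)).rank + 1 = Fintype.card κ).card =
      if p ⬝ᵥ r = 0 then 0 else 1 := by
  have h : ∀ c : F, (P * Q - vecMulVec (c • P *ᵥ p) (r ᵥ* Q)).rank + 1 = Fintype.card κ ↔
      c * (p ⬝ᵥ r) = 1 := by
    intro c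
    rw [rank_sub_add_one_eq_iff hP hQ, ← Matrix.mulVec_smul]
    constructor
    · rintro ⟨p', r', h1, h2, h3⟩
      rw [hP h1.symm, hQ h2.symm, smul_dotProduct, smul_eq_mul] at h3
      exact h3
    · intro h
      exact ⟨c • p, r, rfl, rfl, by rwa [smul_dotProduct, smul_eq_mul]⟩
  simp_rw [h]
  split_ifs with h0
  · simp [h0]
  · rw [Finset.card_eq_one]
    refine ⟨(p ⬝ᵥ r)⁻¹, ?_⟩
    ext c
    simp only [Finset.mem_filter, Finset.mem_univ, true_and, Finset.mem_singleton]
    rw [mul_eq_one_iff_eq_inv₀ h0]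
    constructor
    · exact And.right
    · rintro rfl
      exact ⟨inv_ne_zero h0, rfl⟩

theorem kind_five_of_smul {c : F} {u : m → F} {v : n → F} (h : kind P Q 5 (c • u) v) :
    kind P Q 5 u v := by
  refine ⟨?_, h.2⟩
  rintro ⟨p, rfl⟩
  exact h.1 ⟨c • p, by rw [Matrix.mulVec_smul]⟩

theorem kind_zero_of_smul {c : F} (hc : c ≠ 0) {u : m → F} {v : n → F}
    (h : kind P Q 0 (c • u) v) : (∃ p, u = P *ᵥ p) ∧ ∃ r, v = r ᵥ* Q := by
  obtain ⟨p, r, hp, hr, -⟩ := h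
  exact ⟨⟨c⁻¹ • p, by rw [Matrix.mulVec_smul, ← hp, smul_smul, inv_mul_cancel₀ hc, one_smul]⟩,
    r, hr⟩

end Counting

/-! ### Identification of the y-partition with the six positions -/

section Part

variable {F : Type*} [Field F] [Fintype F] [DecidableEq F] {D N k : ℕ} {x y : Vertex F D N}
  {P : Matrix (Fin D) (Fin k) F} {Q : Matrix (Fin k) (Fin (N - D)) F}

theorem add_mem_sphere_iff (hPQ : y - x = P * Q) {j : ℕ} {w : Vertex F D N} :
    x + w ∈ sphere (graph F D N) j y ↔ (P * Q - w).rank = j := by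
  rw [mem_sphere, rank_sub_comm, ← hPQ, sub_sub]

theorem add_mem_sphere_one_iff {w : Vertex F D N} :
    x + w ∈ sphere (graph F D N) 1 x ↔ w.rank = 1 := by
  rw [mem_sphere, add_sub_cancel_left]

theorem card_sphere_inter (hPQ : y - x = P * Q) (w : Vertex F D N) (j : ℕ) :
    (sphere (graph F D N) 1 x ∩ sphere (graph F D N) 1 (x + w) ∩ sphere (graph F D N) j y).card =
      (Finset.univ.filter fun w' : Vertex F D N =>
        w'.rank = 1 ∧ (w' - w).rank = 1 ∧ (P * Q - w').rank = j).card := by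
  symm
  apply Finset.card_equiv (Equiv.addLeft x)
  intro w'
  rw [Equiv.coe_addLeft, Finset.mem_inter, Finset.mem_inter, add_mem_sphere_iff hPQ,
    add_mem_sphere_one_iff, mem_sphere, add_sub_add_left_eq_sub]
  simp [and_assoc]

theorem dist_eq_of_factorization (hPQ : y - x = P * Q) (hP : Function.Injective P.mulVec)
    (hQ : Function.Injective fun r => r ᵥ* Q) : (graph F D N).dist x y = k := by
  rw [dist_eq_rank, rank_sub_comm, hPQ, rank_mul_of_injective hP hQ, Fintype.card_fin]

/-- The number of neighbours in `Γ(x)` closer to `y`. -/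
theorem card_lower (hk : 1 ≤ k) (hPQ : y - x = P * Q) (hP : Function.Injective P.mulVec)
    (hQ : Function.Injective fun r => r ᵥ* Q) {u : Fin D → F} {v : Fin (N - D) → F}
    (hu : u ≠ 0) (hv : v ≠ 0) (h0 : ¬kind P Q 0 u v) :
    (sphere (graph F D N) 1 x ∩ sphere (graph F D N) 1 (x + vecMulVec u v) ∩
        sphere (graph F D N) (k - 1) y).card +
      (Finset.univ.filter fun c : F => c ≠ 0 ∧
        (P * Q - vecMulVec (c • u) v).rank + 1 = Fintype.card (Fin k)).card =
    (Finset.univ.filter fun v' => v' ≠ 0 ∧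
        (P * Q - vecMulVec u v').rank + 1 = Fintype.card (Fin k)).card +
      (Finset.univ.filter fun u' => u' ≠ 0 ∧
        (P * Q - vecMulVec u' v).rank + 1 = Fintype.card (Fin k)).card := by
  have he : ∀ w : Vertex F D N, (P * Q - w).rank = k - 1 ↔
      (P * Q - w).rank + 1 = Fintype.card (Fin k) := by
    intro w
    rw [Fintype.card_fin]
    omega
  rw [card_sphere_inter hPQ]
  simp_rw [he]
  exact card_common_neighbours hu hv
    (fun w : Vertex F D N => (P * Q - w).rank + 1 = Fintype.card (Fin k))
    (by rwa [rank_sub_add_one_eq_iff hP hQ])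

/-- The number of neighbours in `Γ(x)` farther from `y`. -/
theorem card_upper (hPQ : y - x = P * Q) (hP : Function.Injective P.mulVec)
    (hQ : Function.Injective fun r => r ᵥ* Q) {u : Fin D → F} {v : Fin (N - D) → F}
    (hu : u ≠ 0) (hv : v ≠ 0) (h5 : ¬kind P Q 5 u v) :
    (sphere (graph F D N) 1 x ∩ sphere (graph F D N) 1 (x + vecMulVec u v) ∩
        sphere (graph F D N) (k + 1) y).card =
    (Finset.univ.filter fun v' => v' ≠ 0 ∧
        (P * Q - vecMulVec u v').rank = Fintype.card (Fin k) + 1).card +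
      (Finset.univ.filter fun u' => u' ≠ 0 ∧
        (P * Q - vecMulVec u' v).rank = Fintype.card (Fin k) + 1).card := by
  have h := card_common_neighbours hu hv
    (fun w : Vertex F D N => (P * Q - w).rank = Fintype.card (Fin k) + 1)
    (by rwa [rank_sub_eq_add_one_iff hP hQ])
  rw [← h, card_sphere_inter hPQ, Fintype.card_fin, left_eq_add, Finset.card_eq_zero,
    Finset.filter_eq_empty_iff]
  rintro c - ⟨hc, hr⟩
  have := (rank_sub_eq_add_one_iff hP hQ (c • u) v).1 (by rw [hr, Fintype.card_fin])
  exact h5 (kind_five_of_smul this)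

theorem mem_middlePart_iff (hPQ : y - x = P * Q) (hP : Function.Injective P.mulVec)
    (hQ : Function.Injective fun r => r ᵥ* Q) {u : Fin D → F} {v : Fin (N - D) → F}
    (hu : u ≠ 0) (hv : v ≠ 0) (a b : ℕ)
    (h : kind P Q 1 u v ∨ kind P Q 2 u v ∨ kind P Q 3 u v ∨ kind P Q 4 u v) :
    x + vecMulVec u v ∈ middlePart (graph F D N) x y a b ↔
      (sphere (graph F D N) 1 x ∩ sphere (graph F D N) 1 (x + vecMulVec u v) ∩
        sphere (graph F D N) (k - 1) y).card = a ∧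
      (sphere (graph F D N) 1 x ∩ sphere (graph F D N) 1 (x + vecMulVec u v) ∩
        sphere (graph F D N) (k + 1) y).card = b := by
  rw [middlePart, Finset.mem_filter, dist_eq_of_factorization hPQ hP hQ, Finset.mem_inter,
    add_mem_sphere_iff hPQ, add_mem_sphere_one_iff, rank_vecMulVec_eq_one hu hv,
    rank_sub_eq_card_of_kind hP hQ h, Fintype.card_fin]
  simp

theorem not_kind_zero_five_of_kind (hP : Function.Injective P.mulVec)
    (hQ : Function.Injective fun r => r ᵥ* Q) {u : Fin D → F} {v : Fin (N - D) → F}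
    (h : kind P Q 1 u v ∨ kind P Q 2 u v ∨ kind P Q 3 u v ∨ kind P Q 4 u v) :
    ¬kind P Q 0 u v ∧ ¬kind P Q 5 u v := by
  have hr := rank_sub_eq_card_of_kind hP hQ h
  rw [← rank_sub_add_one_eq_iff hP hQ, ← rank_sub_eq_add_one_iff hP hQ]
  omega

/-- For the middle positions, a vector inside its space contributes q^(k-1) closer neighbours along
its line and an outside one contributes none; the overlap is one exactly when both are inside with
p·r ≠ 0. Farther neighbours come from moving the vector whose partner is outside: u' ranges over q^D
- q^k vectors, or v' over q^(N-D) - q^k. -/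
theorem mem_part_of_kind (hk : 1 ≤ k) (hPQ : y - x = P * Q) (hP : Function.Injective P.mulVec)
    (hQ : Function.Injective fun r => r ᵥ* Q) {u : Fin D → F} {v : Fin (N - D) → F}
    (hu : u ≠ 0) (hv : v ≠ 0) {i : Fin 6} (hi : kind P Q i u v) :
    x + vecMulVec u v ∈ part x y i := by
  have hd := dist_eq_of_factorization hPQ hP hQ
  have hw := rank_vecMulVec_eq_one hu hv
  unfold part
  rw [hd]
  fin_cases i
  · change _ ∈ _ ∩ _
    rw [Finset.mem_inter, add_mem_sphere_iff hPQ, add_mem_sphere_one_iff]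
    have := (rank_sub_add_one_eq_iff hP hQ u v).2 hi
    rw [Fintype.card_fin] at this
    exact ⟨hw, by omega⟩
  · have hm := not_kind_zero_five_of_kind hP hQ (.inl hi)
    change _ ∈ middlePart _ _ _ _ _
    rw [mem_middlePart_iff hPQ hP hQ hu hv _ _ (.inl hi)]
    have h1 := card_lower hk hPQ hP hQ hu hv hm.1
    have h2 := card_upper hPQ hP hQ hu hv hm.2
    obtain ⟨p, r, rfl, rfl, h⟩ := hi
    have hp : p ≠ 0 := by rintro rfl; simp at hu
    have hr : r ≠ 0 := by rintro rfl; simp at hv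
    rw [card_smul_kind_zero hP hQ, card_kind_zero_of_mulVec hP hQ hp,
      card_kind_zero_of_vecMul hP hQ hr, if_pos h, Fintype.card_fin] at h1
    rw [card_kind_five_of_mulVec hP hQ, card_kind_five_of_vecMul hP hQ] at h2
    exact ⟨by omega, by omega⟩
  · have hm := not_kind_zero_five_of_kind hP hQ (.inr (.inl hi))
    change _ ∈ middlePart _ _ _ _ _
    rw [mem_middlePart_iff hPQ hP hQ hu hv _ _ (.inr (.inl hi))]
    have h1 := card_lower hk hPQ hP hQ hu hv hm.1
    have h2 := card_upper hPQ hP hQ hu hv hm.2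
    obtain ⟨p, r, rfl, rfl, h, -⟩ := hi
    have hp : p ≠ 0 := by rintro rfl; simp at hu
    have hr : r ≠ 0 := by rintro rfl; simp at hv
    rw [card_smul_kind_zero hP hQ, card_kind_zero_of_mulVec hP hQ hp,
      card_kind_zero_of_vecMul hP hQ hr, if_neg h, Fintype.card_fin] at h1
    rw [card_kind_five_of_mulVec hP hQ, card_kind_five_of_vecMul hP hQ] at h2
    exact ⟨by omega, by omega⟩
  · have hm := not_kind_zero_five_of_kind hP hQ (.inr (.inr (.inl hi)))
    change _ ∈ middlePart _ _ _ _ _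
    rw [mem_middlePart_iff hPQ hP hQ hu hv _ _ (.inr (.inr (.inl hi)))]
    have h1 := card_lower hk hPQ hP hQ hu hv hm.1
    have h2 := card_upper hPQ hP hQ hu hv hm.2
    obtain ⟨⟨p, rfl⟩, h⟩ := hi
    have hp : p ≠ 0 := by rintro rfl; simp at hu
    have hc : (Finset.univ.filter fun c : F => c ≠ 0 ∧
        (P * Q - vecMulVec (c • P *ᵥ p) v).rank + 1 = Fintype.card (Fin k)).card = 0 := by
      rw [Finset.card_eq_zero, Finset.filter_eq_empty_iff]
      rintro c - ⟨hc, hr⟩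
      exact h (kind_zero_of_smul hc ((rank_sub_add_one_eq_iff hP hQ _ _).1 hr)).2
    rw [hc, card_kind_zero_of_mulVec hP hQ hp, card_kind_zero_of_not_vecMul hP hQ h,
      Fintype.card_fin] at h1
    rw [card_kind_five_of_mulVec hP hQ, card_kind_five_of_not_vecMul hP hQ h,
      Fintype.card_fin, Fintype.card_fin] at h2
    exact ⟨by omega, by omega⟩
  · have hm := not_kind_zero_five_of_kind hP hQ (.inr (.inr (.inr hi)))
    change _ ∈ middlePart _ _ _ _ _
    rw [mem_middlePart_iff hPQ hP hQ hu hv _ _ (.inr (.inr (.inr hi)))]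
    have h1 := card_lower hk hPQ hP hQ hu hv hm.1
    have h2 := card_upper hPQ hP hQ hu hv hm.2
    obtain ⟨h, ⟨r, rfl⟩⟩ := hi
    have hr : r ≠ 0 := by rintro rfl; simp at hv
    have hc : (Finset.univ.filter fun c : F => c ≠ 0 ∧
        (P * Q - vecMulVec (c • u) (r ᵥ* Q)).rank + 1 = Fintype.card (Fin k)).card = 0 := by
      rw [Finset.card_eq_zero, Finset.filter_eq_empty_iff]
      rintro c - ⟨hc, hr⟩
      exact h (kind_zero_of_smul hc ((rank_sub_add_one_eq_iff hP hQ _ _).1 hr)).1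
    rw [hc, card_kind_zero_of_vecMul hP hQ hr, card_kind_zero_of_not_mulVec hP hQ h,
      Fintype.card_fin] at h1
    rw [card_kind_five_of_vecMul hP hQ, card_kind_five_of_not_mulVec hP hQ h,
      Fintype.card_fin, Fintype.card_fin] at h2
    exact ⟨by omega, by omega⟩
  · change _ ∈ _ ∩ _
    rw [Finset.mem_inter, add_mem_sphere_iff hPQ, add_mem_sphere_one_iff]
    have := (rank_sub_eq_add_one_iff hP hQ u v).2 hi
    rw [Fintype.card_fin] at this
    exact ⟨hw, this⟩

theorem part_subset_sphere (i : Fin 6) : part x y i ⊆ sphere (graph F D N) 1 x := by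
  have hm : ∀ a b, middlePart (graph F D N) x y a b ⊆ sphere (graph F D N) 1 x := fun a b =>
    (Finset.filter_subset _ _).trans Finset.inter_subset_left
  fin_cases i
  exacts [Finset.inter_subset_left, hm _ _, hm _ _, hm _ _, hm _ _, Finset.inter_subset_left]

theorem disjoint_sphere {X : Type*} [Fintype X] [DecidableEq X] (G : SimpleGraph X) {i j : ℕ}
    (h : i ≠ j) (x : X) : Disjoint (sphere G i x) (sphere G j x) := by
  rw [Finset.disjoint_left]
  intro z hi hj
  exact h ((Finset.mem_filter.1 hi).2.symm.trans (Finset.mem_filter.1 hj).2)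

theorem disjoint_middlePart {X : Type*} [Fintype X] [DecidableEq X] (G : SimpleGraph X) (x y : X)
    {a b a' b' : ℕ} (h : a ≠ a' ∨ b ≠ b') :
    Disjoint (middlePart G x y a b) (middlePart G x y a' b') := by
  rw [Finset.disjoint_left]
  intro z hi hj
  have h1 := (Finset.mem_filter.1 hi).2
  have h2 := (Finset.mem_filter.1 hj).2
  rcases h with h | h
  · exact h (h1.1.symm.trans h2.1)
  · exact h (h1.2.symm.trans h2.2)

theorem middlePart_subset_sphere {X : Type*} [Fintype X] [DecidableEq X] (G : SimpleGraph X)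
    (x y : X) (a b : ℕ) : middlePart G x y a b ⊆ sphere G (G.dist x y) y :=
  (Finset.filter_subset _ _).trans Finset.inter_subset_right

theorem part_eq (x y : Vertex F D N) : part x y =
    ![sphere (graph F D N) 1 x ∩ sphere (graph F D N) ((graph F D N).dist x y - 1) y,
      middlePart (graph F D N) x y (2 * Fintype.card F ^ ((graph F D N).dist x y - 1)) 0,
      middlePart (graph F D N) x y (2 * Fintype.card F ^ ((graph F D N).dist x y - 1) - 1) 0,
      middlePart (graph F D N) x y (Fintype.card F ^ ((graph F D N).dist x y - 1))
        (Fintype.card F ^ D - Fintype.card F ^ (graph F D N).dist x y),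
      middlePart (graph F D N) x y (Fintype.card F ^ ((graph F D N).dist x y - 1))
        (Fintype.card F ^ (N - D) - Fintype.card F ^ (graph F D N).dist x y),
      sphere (graph F D N) 1 x ∩ sphere (graph F D N) ((graph F D N).dist x y + 1) y] := rfl

theorem pairwise_disjoint_of_lt {X : Type*} {O : Fin 6 → Finset X}
    (h0 : ∀ j, 0 < j → Disjoint (O 0) (O j)) (h1 : ∀ j, 1 < j → Disjoint (O 1) (O j))
    (h2 : ∀ j, 2 < j → Disjoint (O 2) (O j)) (h3 : ∀ j, 3 < j → Disjoint (O 3) (O j))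
    (h4 : Disjoint (O 4) (O 5)) {i j : Fin 6} (hij : i ≠ j) : Disjoint (O i) (O j) := by
  wlog h : i < j generalizing i j
  · exact (this hij.symm (lt_of_le_of_ne (not_lt.1 h) hij.symm)).symm
  obtain rfl | rfl | rfl | rfl | ⟨rfl, rfl⟩ :
      i = 0 ∨ i = 1 ∨ i = 2 ∨ i = 3 ∨ i = 4 ∧ j = 5 := by
    omega
  exacts [h0 j h, h1 j h, h2 j h, h3 j h, h4]

/-- The parts differ in distance to y or in (m, n). Here k < D < N - D makes 0, q^D - q^k and
q^(N-D) - q^k distinct, and q^(k-1) > 0 makes the subtraction in 2q^(k-1) - 1 genuine. -/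
theorem part_disjoint (hk : 1 ≤ (graph F D N).dist x y) (hk' : (graph F D N).dist x y < D)
    (hN : D < N - D) {i j : Fin 6} (hij : i ≠ j) : Disjoint (part x y i) (part x y j) := by
  have hq : 1 < Fintype.card F := Fintype.one_lt_card
  have h1 := Nat.pow_lt_pow_right hq hk'
  have h2 := Nat.pow_lt_pow_right hq hN
  have h3 : 0 < Fintype.card F ^ ((graph F D N).dist x y - 1) := Nat.pow_pos (by omega)
  have hmid : ∀ (a b l : ℕ), l ≠ (graph F D N).dist x y → Disjoint
      (middlePart (graph F D N) x y a b) (sphere (graph F D N) 1 x ∩ sphere (graph F D N) l y) :=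
    fun a b l hl => (disjoint_sphere _ hl.symm y).mono (middlePart_subset_sphere _ _ _ _ _)
      Finset.inter_subset_right
  have hsph : Disjoint
      (sphere (graph F D N) 1 x ∩ sphere (graph F D N) ((graph F D N).dist x y - 1) y)
      (sphere (graph F D N) 1 x ∩ sphere (graph F D N) ((graph F D N).dist x y + 1) y) :=
    (disjoint_sphere _ (by omega) y).mono Finset.inter_subset_right Finset.inter_subset_right
  rw [part_eq]
  have hlow : (graph F D N).dist x y - 1 ≠ (graph F D N).dist x y := by omega
  have hupp : (graph F D N).dist x y + 1 ≠ (graph F D N).dist x y := by omega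
  refine pairwise_disjoint_of_lt ?_ ?_ ?_ ?_ (hmid _ _ _ hupp) hij
  · simp only [Fin.forall_fin_succ, IsEmpty.forall_iff]
    exact ⟨fun h => absurd h (by decide), fun _ => (hmid _ _ _ hlow).symm,
      fun _ => (hmid _ _ _ hlow).symm, fun _ => (hmid _ _ _ hlow).symm,
      fun _ => (hmid _ _ _ hlow).symm, fun _ => hsph, trivial⟩
  · simp only [Fin.forall_fin_succ, IsEmpty.forall_iff]
    exact ⟨fun h => absurd h (by decide), fun h => absurd h (by decide),
      fun _ => disjoint_middlePart _ _ _ (.inl (by omega)),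
      fun _ => disjoint_middlePart _ _ _ (.inr (by omega)),
      fun _ => disjoint_middlePart _ _ _ (.inr (by omega)), fun _ => hmid _ _ _ hupp, trivial⟩
  · simp only [Fin.forall_fin_succ, IsEmpty.forall_iff]
    exact ⟨fun h => absurd h (by decide), fun h => absurd h (by decide),
      fun h => absurd h (by decide), fun _ => disjoint_middlePart _ _ _ (.inr (by omega)),
      fun _ => disjoint_middlePart _ _ _ (.inr (by omega)), fun _ => hmid _ _ _ hupp, trivial⟩
  · simp only [Fin.forall_fin_succ, IsEmpty.forall_iff]
    exact ⟨fun h => absurd h (by decide), fun h => absurd h (by decide),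
      fun h => absurd h (by decide), fun h => absurd h (by decide),
      fun _ => disjoint_middlePart _ _ _ (.inr (by omega)), fun _ => hmid _ _ _ hupp, trivial⟩

theorem exists_vecMulVec_of_mem_sphere {z : Vertex F D N} (hz : z ∈ sphere (graph F D N) 1 x) :
    ∃ u v, u ≠ 0 ∧ v ≠ 0 ∧ z = x + vecMulVec u v := by
  obtain ⟨u, v, hu, hv, h⟩ := rank_eq_one_iff.1 (mem_sphere.1 hz)
  exact ⟨u, v, hu, hv, by rw [← h, add_sub_cancel]⟩

theorem biUnion_part (hk : 1 ≤ (graph F D N).dist x y) :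
    Finset.univ.biUnion (part x y) = sphere (graph F D N) 1 x := by
  apply Finset.Subset.antisymm
  · exact Finset.biUnion_subset.2 fun i _ => part_subset_sphere i
  · intro z hz
    obtain ⟨P, Q, hPQ, hP, hQ⟩ := exists_rank_factorization (y - x) rfl
    rw [dist_eq_rank, rank_sub_comm] at hk
    obtain ⟨u, v, hu, hv, rfl⟩ := exists_vecMulVec_of_mem_sphere hz
    obtain ⟨i, hi⟩ := exists_kind P Q u v
    exact Finset.mem_biUnion.2 ⟨i, Finset.mem_univ _, mem_part_of_kind hk hPQ hP hQ hu hv hi⟩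

/-- The positions exhaust all pairs and the parts are disjoint, so the implication from position to
part is already an equivalence. -/
theorem mem_part_iff_kind (hk : 1 ≤ k) (hk' : k < D) (hN : D < N - D) (hPQ : y - x = P * Q)
    (hP : Function.Injective P.mulVec) (hQ : Function.Injective fun r => r ᵥ* Q)
    {u : Fin D → F} {v : Fin (N - D) → F} (hu : u ≠ 0) (hv : v ≠ 0) (i : Fin 6) :
    x + vecMulVec u v ∈ part x y i ↔ kind P Q i u v := by
  refine ⟨fun h => ?_, mem_part_of_kind hk hPQ hP hQ hu hv⟩
  obtain ⟨j, hj⟩ := exists_kind P Q u v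
  have hj' := mem_part_of_kind hk hPQ hP hQ hu hv hj
  have hd := dist_eq_of_factorization hPQ hP hQ
  by_cases hij : i = j
  · rwa [hij]
  · exact absurd hj' (Finset.disjoint_left.1
      (part_disjoint (by omega) (by omega) hN hij) h)

theorem exists_ne_mulVec (hk : k < D) (P : Matrix (Fin D) (Fin k) F) :
    ∃ u, ¬∃ p, u = P *ᵥ p := by
  by_contra! h
  have hs : Function.Surjective P.mulVec := fun u => (h u).imp fun _ => Eq.symm
  have := Fintype.card_le_of_surjective _ hs
  rw [Fintype.card_fun, Fintype.card_fun, Fintype.card_fin, Fintype.card_fin] at this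
  exact absurd this (not_le.2 (Nat.pow_lt_pow_right Fintype.one_lt_card hk))

theorem part_nonempty (hq : Fintype.card F ≠ 2) (hk : 2 ≤ (graph F D N).dist x y)
    (hk' : (graph F D N).dist x y < D) (hN : D < N - D) (i : Fin 6) : (part x y i).Nonempty := by
  obtain ⟨P, Q, hPQ, hP, hQ⟩ := exists_rank_factorization (y - x) rfl
  rw [dist_eq_rank, rank_sub_comm] at hk hk'
  generalize (y - x).rank = k at *
  suffices ∃ u v, u ≠ 0 ∧ v ≠ 0 ∧ kind P Q i u v by
    obtain ⟨u, v, hu, hv, h⟩ := this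
    exact ⟨_, mem_part_of_kind (by omega) hPQ hP hQ hu hv h⟩
  have hP0 : ∀ p, p ≠ 0 → P *ᵥ p ≠ 0 := fun p hp h => hp (hP (by simpa using h))
  have hQ0 : ∀ r, r ≠ 0 → r ᵥ* Q ≠ 0 := fun r hr h => hr (hQ (by simpa using h))
  obtain ⟨u, hu⟩ := exists_ne_mulVec hk' P
  obtain ⟨v, hv⟩ := exists_ne_mulVec (hk'.trans hN) Qᵀ
  simp only [Matrix.mulVec_transpose] at hv
  have hu0 : u ≠ 0 := by rintro rfl; exact hu ⟨0, by simp⟩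
  have hv0 : v ≠ 0 := by rintro rfl; exact hv ⟨0, by simp⟩
  let e : Fin k → F := Pi.single ⟨0, by omega⟩ 1
  let e' : Fin k → F := Pi.single ⟨1, by omega⟩ 1
  have he : e ≠ 0 := by simp [e]
  have he' : e' ≠ 0 := by simp [e']
  -- O_3 needs a value of p·r other than 0 and 1; this is where q ≠ 2 enters.
  obtain ⟨c, hc0, hc1⟩ : ∃ c : F, c ≠ 0 ∧ c ≠ 1 := by
    by_contra! hc
    have h2 : Fintype.card F ≤ ({0, 1} : Finset F).card :=
      Finset.card_le_card fun c _ => by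
        by_cases h0 : c = 0 <;> simp [h0, hc c]
    have h1 : 1 < Fintype.card F := Fintype.one_lt_card
    rw [Finset.card_pair zero_ne_one] at h2
    omega
  fin_cases i
  · exact ⟨_, _, hP0 e he, hQ0 e he, e, e, rfl, rfl, by simp [e]⟩
  · exact ⟨_, _, hP0 e he, hQ0 e' he', e, e', rfl, rfl, by simp [e, e']⟩
  · exact ⟨_, _, hP0 e he, hQ0 (c • e) (smul_ne_zero hc0 he), e, c • e, rfl, rfl, by simpa [e],
      by simpa [e]⟩
  · exact ⟨_, v, hP0 e he, hv0, ⟨e, rfl⟩, hv⟩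
  · exact ⟨u, _, hu0, hQ0 e he, hu, ⟨e, rfl⟩⟩
  · exact ⟨u, v, hu0, hv0, hu, hv⟩

end Part

/-! ### Character sums over pairs of vectors and over quadrics -/

section FactorSums

variable {F : Type*} [Field F] [Fintype F] [DecidableEq F] {m n κ κ' : Type*} [Fintype m]
  [Fintype n] [Fintype κ] [Fintype κ'] [DecidableEq m] [DecidableEq n] [DecidableEq κ]
  [DecidableEq κ'] {ψ : AddChar F ℂ}

open Classical in
/-- The sum of `ψ (⟨a, u⟩ ⟨b, v⟩)` over the pairs `(u, v)` with a given property. -/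
noncomputable def pairSum (ψ : AddChar F ℂ) (R : (m → F) → (n → F) → Prop) (a : m → F)
    (b : n → F) : ℂ :=
  ∑ u, ∑ v, if R u v then ψ ((a ⬝ᵥ u) * (b ⬝ᵥ v)) else 0

theorem pairSum_congr {R R' : (m → F) → (n → F) → Prop} (h : ∀ u v, R u v ↔ R' u v)
    (a : m → F) (b : n → F) : pairSum ψ R a b = pairSum ψ R' a b := by
  have : R = R' := by
    ext u v
    exact h u v
  rw [this]

/-- The substitution u = Pp, v = rQ is injective and turns a·u, b·v into (aP)·p, (Qb)·r. -/
theorem pairSum_factor {P : Matrix m κ F} {Q : Matrix κ' n F} (hP : Function.Injective P.mulVec)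
    (hQ : Function.Injective fun r => r ᵥ* Q) (R : (κ → F) → (κ' → F) → Prop) (a : m → F)
    (b : n → F) :
    pairSum ψ (fun u v => ∃ p r, u = P *ᵥ p ∧ v = r ᵥ* Q ∧ R p r) a b =
      pairSum ψ R (a ᵥ* P) (Q *ᵥ b) := by
  classical
  unfold pairSum
  simp_rw [← Fintype.sum_prod_type']
  trans ∑ s ∈ Finset.univ.filter fun s : (m → F) × (n → F) =>
      ∃ p r, s.1 = P *ᵥ p ∧ s.2 = r ᵥ* Q ∧ R p r, ψ ((a ⬝ᵥ s.1) * (b ⬝ᵥ s.2))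
  · rw [Finset.sum_filter]
    exact Finset.sum_congr rfl fun _ _ => by congr
  rw [← Finset.sum_filter]
  symm
  apply Finset.sum_bij (fun s _ => (P *ᵥ s.1, s.2 ᵥ* Q))
  · rintro ⟨p, r⟩ h
    simp only [Finset.mem_filter, Finset.mem_univ, true_and] at h ⊢
    exact ⟨p, r, rfl, rfl, h⟩
  · rintro ⟨p, r⟩ _ ⟨p', r'⟩ _ h
    rw [Prod.mk.injEq] at h
    exact Prod.ext (hP h.1) (hQ h.2)
  · rintro ⟨u, v⟩ h
    simp only [Finset.mem_filter, Finset.mem_univ, true_and] at h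
    obtain ⟨p, r, rfl, rfl, h⟩ := h
    exact ⟨(p, r), by simpa using h, rfl⟩
  · rintro ⟨p, r⟩ _
    change ψ ((a ᵥ* P) ⬝ᵥ p * (Q *ᵥ b) ⬝ᵥ r) = ψ (a ⬝ᵥ P *ᵥ p * b ⬝ᵥ r ᵥ* Q)
    rw [← Matrix.dotProduct_mulVec, dotProduct_comm (Q *ᵥ b), Matrix.dotProduct_mulVec r,
      dotProduct_comm (r ᵥ* Q)]

theorem dotProduct_vecMulVec_mulVec (a u : m → F) (b v : n → F) :
    u ⬝ᵥ vecMulVec a b *ᵥ v = (a ⬝ᵥ u) * (b ⬝ᵥ v) := by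
  rw [Matrix.dotProduct_mulVec, Matrix.vecMul_vecMulVec, smul_dotProduct, smul_eq_mul,
    dotProduct_comm u]

theorem rank_vecMulVec_eq_ite (a : m → F) (b : n → F) :
    (vecMulVec a b).rank = if a ≠ 0 ∧ b ≠ 0 then 1 else 0 := by
  split_ifs with h
  · exact rank_vecMulVec_eq_one h.1 h.2
  · rw [vecMulVec_eq_zero_iff.2 (by tauto), Matrix.rank_zero]

theorem pairSum_ne_zero (hψ : ψ.IsPrimitive) (a : m → F) (b : n → F) :
    pairSum ψ (fun u v => u ≠ 0 ∧ v ≠ 0) a b =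
      (Fintype.card F : ℂ) ^ Fintype.card m *
          (Fintype.card F : ℂ) ^ (Fintype.card n - if a ≠ 0 ∧ b ≠ 0 then 1 else 0)
        - (Fintype.card F : ℂ) ^ Fintype.card n - (Fintype.card F : ℂ) ^ Fintype.card m + 1 := by
  rw [← rank_vecMulVec_eq_ite, ← sum_pairs_apply_dotProduct_mulVec hψ, pairSum]
  simp_rw [dotProduct_vecMulVec_mulVec]
  refine Finset.sum_congr rfl fun u _ => Finset.sum_congr rfl fun v _ => ?_
  congr

theorem rank_vecMulVec_add_smul_one {c : F} (hc : c ≠ 0) (a b : κ → F) :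
    (vecMulVec a b + c • (1 : Matrix κ κ F)).rank = (1 - vecMulVec (-(c⁻¹ • a)) b).rank := by
  have h : vecMulVec a b + c • (1 : Matrix κ κ F) = c • (1 - vecMulVec (-(c⁻¹ • a)) b) := by
    rw [smul_sub, neg_vecMulVec, smul_vecMulVec, smul_neg, smul_smul, mul_inv_cancel₀ hc, one_smul,
      sub_neg_eq_add, add_comm]
  rw [h, Matrix.rank_smul_of_mem_nonZeroDivisors _ (mem_nonZeroDivisors_of_ne_zero hc)]

/-- For c ≠ 0 the matrix abᵀ + c·1 is invertible unless a·b = -c, when its rank drops by one; the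
power is therefore 1 or q. -/
theorem pow_card_sub_rank {c : F} (hc : c ≠ 0) (a b : κ → F) :
    (Fintype.card F : ℂ) ^
        (Fintype.card κ - (vecMulVec a b + c • (1 : Matrix κ κ F)).rank) =
      1 + if a ⬝ᵥ b = -c then (Fintype.card F : ℂ) - 1 else 0 := by
  rw [rank_vecMulVec_add_smul_one hc]
  have h : -(c⁻¹ • a) ⬝ᵥ b = 1 ↔ a ⬝ᵥ b = -c := by
    rw [neg_dotProduct, smul_dotProduct, smul_eq_mul, neg_eq_iff_eq_neg, inv_mul_eq_iff_eq_mul₀ hc,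
      mul_neg_one]
  split_ifs with h1
  · have := rank_one_sub_vecMulVec_add_one (h.2 h1)
    rw [← this, Nat.add_sub_cancel_left]
    simp
  · rw [rank_one_sub_vecMulVec (mt h.1 h1)]
    simp

/-- The character sum over the quadric `⟨p, r⟩ = e`. -/
theorem card_mul_pairSum_dotProduct_eq (hψ : ψ.IsPrimitive) (e : F) (a b : κ → F) :
    (Fintype.card F : ℂ) * pairSum ψ (fun p r => p ⬝ᵥ r = e) a b =
      (Fintype.card F : ℂ) ^ Fintype.card κ *
        ((Fintype.card F : ℂ) ^ (Fintype.card κ - if a ≠ 0 ∧ b ≠ 0 then 1 else 0)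
          + ((if e = 0 then (Fintype.card F : ℂ) else 0) - 1)
          + ((Fintype.card F : ℂ) - 1) * if a ⬝ᵥ b ≠ 0 then ψ ((a ⬝ᵥ b) * e) else 0) := by
  -- The condition p·r = e is detected by averaging ψ(c(p·r - e)) over c; for each c this leaves a
  -- full sum for the bilinear form abᵀ + c·1.
  have h1 : (Fintype.card F : ℂ) * pairSum ψ (fun p r => p ⬝ᵥ r = e) a b =
      ∑ c : F, ψ (-(c * e)) * ∑ p : κ → F, ∑ r : κ → F,
        ψ (p ⬝ᵥ (vecMulVec a b + c • (1 : Matrix κ κ F)) *ᵥ r) := by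
    simp_rw [pairSum, Finset.mul_sum]
    symm
    rw [Finset.sum_comm]
    refine Finset.sum_congr rfl fun p _ => ?_
    rw [Finset.sum_comm]
    refine Finset.sum_congr rfl fun r _ => ?_
    have h2 : ∀ c : F, ψ (-(c * e)) * ψ (p ⬝ᵥ (vecMulVec a b + c • (1 : Matrix κ κ F)) *ᵥ r) =
        ψ ((a ⬝ᵥ p) * (b ⬝ᵥ r)) * ψ (c * (p ⬝ᵥ r - e)) := by
      intro c
      rw [← AddChar.map_add_eq_mul, ← AddChar.map_add_eq_mul, Matrix.add_mulVec, dotProduct_add,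
        dotProduct_vecMulVec_mulVec, Matrix.smul_mulVec, Matrix.one_mulVec, dotProduct_smul,
        smul_eq_mul]
      congr 1
      ring
    simp_rw [h2]
    rw [← Finset.mul_sum, AddChar.sum_mulShift _ hψ]
    by_cases h : p ⬝ᵥ r = e
    · simp [h, mul_comm]
    · simp [h, sub_eq_zero]
  have hsum : ∑ c ∈ Finset.univ.erase (0 : F), ψ (-(c * e)) =
      (if e = 0 then (Fintype.card F : ℂ) else 0) - 1 := by
    have h := AddChar.sum_mulShift (-e) hψ
    rw [← Finset.add_sum_erase _ _ (Finset.mem_univ 0)] at h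
    simp only [mul_neg, zero_mul, neg_zero, AddChar.map_zero_eq_one, neg_eq_zero] at h
    push_cast at h
    linear_combination h
  have hdelta : ∑ c ∈ Finset.univ.erase (0 : F),
      ψ (-(c * e)) * (if a ⬝ᵥ b = -c then (Fintype.card F : ℂ) - 1 else 0) =
      ((Fintype.card F : ℂ) - 1) * if a ⬝ᵥ b ≠ 0 then ψ ((a ⬝ᵥ b) * e) else 0 := by
    by_cases h0 : a ⬝ᵥ b = 0
    · rw [if_neg (not_not.2 h0), mul_zero]
      refine Finset.sum_eq_zero fun c hc => ?_
      rw [if_neg, mul_zero]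
      rw [h0]
      exact fun h => Finset.ne_of_mem_erase hc (by simpa using h.symm)
    · rw [if_pos h0, Finset.sum_eq_single (-(a ⬝ᵥ b))]
      · simp [mul_comm]
      · intro c _ hc
        rw [if_neg, mul_zero]
        rintro h
        exact hc (by rw [h, neg_neg])
      · intro h
        simp [h0] at h
  rw [h1]
  simp_rw [sum_sum_apply_dotProduct_mulVec hψ]
  rw [← Finset.add_sum_erase _ _ (Finset.mem_univ 0), zero_smul, add_zero, zero_mul, neg_zero,
    AddChar.map_zero_eq_one, one_mul, rank_vecMulVec_eq_ite,
    Finset.sum_congr rfl (g := fun c => (Fintype.card F : ℂ) ^ Fintype.card κ *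
      (ψ (-(c * e)) + ψ (-(c * e)) * if a ⬝ᵥ b = -c then (Fintype.card F : ℂ) - 1 else 0))]
  · rw [← Finset.mul_sum, Finset.sum_add_distrib, hsum, hdelta]
    ring
  · intro c hc
    rw [pow_card_sub_rank (Finset.ne_of_mem_erase hc)]
    ring

/-- The pairs with p = 0 and those with r = 0 all satisfy p·r = 0 and contribute 1 each; (0, 0) is
removed twice. -/
theorem pairSum_ne_zero_dotProduct_eq_zero (a b : κ → F) :
    pairSum ψ (fun p r => p ≠ 0 ∧ r ≠ 0 ∧ p ⬝ᵥ r = 0) a b =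
      pairSum ψ (fun p r => p ⬝ᵥ r = 0) a b - 2 * (Fintype.card F : ℂ) ^ Fintype.card κ + 1 := by
  classical
  have h := sum_pairs_ne_zero (F := F) (m := κ) (n := κ)
    (fun p r => if p ⬝ᵥ r = 0 then ψ ((a ⬝ᵥ p) * (b ⬝ᵥ r)) else 0)
  simp only [zero_dotProduct, dotProduct_zero, if_true, zero_mul, mul_zero,
    AddChar.map_zero_eq_one, Finset.sum_const, Finset.card_univ, Fintype.card_fun, nsmul_eq_mul,
    mul_one, Nat.cast_pow] at h
  have h1 : pairSum ψ (fun p r => p ≠ 0 ∧ r ≠ 0 ∧ p ⬝ᵥ r = 0) a b =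
      ∑ p : κ → F, ∑ r : κ → F, if p ≠ 0 ∧ r ≠ 0 then
        (if p ⬝ᵥ r = 0 then ψ ((a ⬝ᵥ p) * (b ⬝ᵥ r)) else 0) else 0 := by
    refine Finset.sum_congr rfl fun p _ => Finset.sum_congr rfl fun r _ => ?_
    rw [← ite_and]
    simp only [and_assoc]
    congr
  have h2 : pairSum ψ (fun p r => p ⬝ᵥ r = 0) a b =
      ∑ p : κ → F, ∑ r : κ → F, if p ⬝ᵥ r = 0 then ψ ((a ⬝ᵥ p) * (b ⬝ᵥ r)) else 0 := by
    refine Finset.sum_congr rfl fun p _ => Finset.sum_congr rfl fun r _ => ?_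
    congr
  rw [h1, h, h2]
  ring

end FactorSums

/-! ### Reduction of E to the transform at rank one matrices -/

section Transform

variable {F : Type*} [Field F] [Fintype F] [DecidableEq F] {D N k : ℕ} {x y : Vertex F D N}
  {P : Matrix (Fin D) (Fin k) F} {Q : Matrix (Fin k) (Fin (N - D)) F} {ψ : AddChar F ℂ}

/-- The pairs of nonzero vectors; `(a, b)` stands for the rank one matrix `a bᵀ`. -/
abbrev NonzeroPair (F : Type*) [Field F] (D N : ℕ) : Type _ :=
  {p : (Fin D → F) × (Fin (N - D) → F) // p.1 ≠ 0 ∧ p.2 ≠ 0}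

/-- The Fourier transform restricted to the matrices of rank one. -/
noncomputable def rankOneFourier (ψ : AddChar F ℂ) :
    (Vertex F D N → ℝ) →ₗ[ℝ] NonzeroPair F D N → ℂ :=
  LinearMap.funLeft ℝ ℂ (fun s : NonzeroPair F D N => vecMulVec s.1.1 s.1.2) ∘ₗ fourier ψ

theorem rankOneFourier_apply (w : Vertex F D N → ℝ) (s : NonzeroPair F D N) :
    rankOneFourier ψ w s = fourier ψ w (vecMulVec s.1.1 s.1.2) := rfl

/-- Thus E and `rankOneFourier` have the same kernel, which lets linear relations pass between the
two sides. -/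
theorem idem_mulVec_eq_zero_iff (hψ : ψ.IsPrimitive) (hD : 0 < D) (hN : 0 < N - D)
    (w : Vertex F D N → ℝ) : idem F D N *ᵥ w = 0 ↔ rankOneFourier ψ w = 0 := by
  constructor
  · intro h
    ext s
    have := fourier_idem_mulVec hψ hD hN w (vecMulVec s.1.1 s.1.2)
    rw [h, if_pos (rank_vecMulVec_eq_one s.2.1 s.2.2), map_zero] at this
    rw [rankOneFourier_apply, ← this]
    rfl
  · intro h
    apply fourier_injective hψ
    ext C
    rw [fourier_idem_mulVec hψ hD hN, map_zero, Pi.zero_apply]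
    split_ifs with hC
    · obtain ⟨a, b, ha, hb, rfl⟩ := rank_eq_one_iff.1 hC
      exact congrFun h ⟨(a, b), ha, hb⟩
    · rfl

theorem fourier_hat (Ω : Finset (Vertex F D N)) (C : Vertex F D N) :
    fourier ψ (hat Ω) C = ∑ z ∈ Ω, ψ (pairing C z) := by
  rw [hat, map_sum, Finset.sum_apply]
  refine Finset.sum_congr rfl fun z _ => ?_
  rw [fourier_apply, Finset.sum_eq_single z]
  · simp
  · intro w _ hw
    simp [hw]
  · simp

theorem pairing_vecMulVec_left (a : Fin D → F) (b : Fin (N - D) → F) (z : Vertex F D N) :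
    pairing (vecMulVec a b) z = a ⬝ᵥ z *ᵥ b := by
  rw [pairing_comm, pairing_vecMulVec]

/-- The factor q - 1 is the number of pairs (u, v) giving one rank one matrix; ψ(aᵀxb) comes from
translating by x. -/
theorem rankOneFourier_hat_of_subset {Ω : Finset (Vertex F D N)}
    (hΩ : Ω ⊆ sphere (graph F D N) 1 x) (s : NonzeroPair F D N) :
    ((Fintype.card F : ℂ) - 1) * rankOneFourier ψ (hat Ω) s =
      ψ (s.1.1 ⬝ᵥ x *ᵥ s.1.2) * pairSum ψ
        (fun u v => (u ≠ 0 ∧ v ≠ 0) ∧ x + vecMulVec u v ∈ Ω) s.1.1 s.1.2 := by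
  have h := sum_pairs_vecMulVec fun w : Vertex F D N =>
    if x + w ∈ Ω then ψ (pairing (vecMulVec s.1.1 s.1.2) (x + w)) else 0
  rw [rankOneFourier_apply, fourier_hat]
  have h1 : (∑ w : Vertex F D N, if w.rank = 1 then
      (if x + w ∈ Ω then ψ (pairing (vecMulVec s.1.1 s.1.2) (x + w)) else 0) else 0) =
      ∑ z ∈ Ω, ψ (pairing (vecMulVec s.1.1 s.1.2) z) := by
    have h2 : ∑ z ∈ Ω, ψ (pairing (vecMulVec s.1.1 s.1.2) z) =
        ∑ z, if z ∈ Ω then ψ (pairing (vecMulVec s.1.1 s.1.2) z) else 0 := by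
      rw [Finset.sum_ite_mem, Finset.univ_inter]
    rw [h2]
    refine Eq.trans ?_ (Equiv.sum_comp (Equiv.addLeft x) _)
    refine Finset.sum_congr rfl fun w _ => ?_
    rw [Equiv.coe_addLeft]
    by_cases hw : x + w ∈ Ω
    · rw [if_pos hw, if_pos (add_mem_sphere_one_iff.1 (hΩ hw))]
    · simp [hw]
  rw [← h1, ← h, pairSum, Finset.mul_sum]
  refine Finset.sum_congr rfl fun u _ => ?_
  rw [Finset.mul_sum]
  refine Finset.sum_congr rfl fun v _ => ?_
  by_cases huv : (u ≠ 0 ∧ v ≠ 0) ∧ x + vecMulVec u v ∈ Ω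
  · rw [if_pos huv.1, if_pos huv.2, if_pos huv, pairing_add, AddChar.map_add_eq_mul,
      pairing_vecMulVec, pairing_vecMulVec_left, dotProduct_vecMulVec_mulVec]
  · rw [if_neg huv, mul_zero, ← ite_and, if_neg huv]

end Transform

/-! ### Six functions spanning the transform of S(x, y) -/

section Basis

variable {F : Type*} [Field F] [Fintype F] [DecidableEq F] {D N k : ℕ} {x y : Vertex F D N}
  {P : Matrix (Fin D) (Fin k) F} {Q : Matrix (Fin k) (Fin (N - D)) F} {ψ : AddChar F ℂ}

/-- Six functions on the rank one matrices `a bᵀ` that span the transform of `S(x, y)`. -/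
noncomputable def basisFun (ψ : AddChar F ℂ) (x y : Vertex F D N) (j : Fin 6)
    (s : NonzeroPair F D N) : ℂ :=
  ψ (s.1.1 ⬝ᵥ x *ᵥ s.1.2) *
    ![1,
      if s.1.1 ᵥ* (y - x) ≠ 0 then 1 else 0,
      if (y - x) *ᵥ s.1.2 ≠ 0 then 1 else 0,
      if s.1.1 ᵥ* (y - x) ≠ 0 ∧ (y - x) *ᵥ s.1.2 ≠ 0 then 1 else 0,
      if s.1.1 ⬝ᵥ (y - x) *ᵥ s.1.2 ≠ 0 then 1 else 0,
      if s.1.1 ⬝ᵥ (y - x) *ᵥ s.1.2 ≠ 0 then ψ (s.1.1 ⬝ᵥ (y - x) *ᵥ s.1.2) else 0] j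

theorem basisFun_eq_of_factorization (hPQ : y - x = P * Q) (hP : Function.Injective P.mulVec)
    (hQ : Function.Injective fun r => r ᵥ* Q) (j : Fin 6) (s : NonzeroPair F D N) :
    basisFun ψ x y j s = ψ (s.1.1 ⬝ᵥ x *ᵥ s.1.2) *
      ![1,
        if s.1.1 ᵥ* P ≠ 0 then 1 else 0,
        if Q *ᵥ s.1.2 ≠ 0 then 1 else 0,
        if s.1.1 ᵥ* P ≠ 0 ∧ Q *ᵥ s.1.2 ≠ 0 then 1 else 0,
        if (s.1.1 ᵥ* P) ⬝ᵥ (Q *ᵥ s.1.2) ≠ 0 then 1 else 0,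
        if (s.1.1 ᵥ* P) ⬝ᵥ (Q *ᵥ s.1.2) ≠ 0 then ψ ((s.1.1 ᵥ* P) ⬝ᵥ (Q *ᵥ s.1.2)) else 0] j := by
  have h1 : s.1.1 ᵥ* (y - x) = 0 ↔ s.1.1 ᵥ* P = 0 := by
    rw [hPQ, ← Matrix.vecMul_vecMul]
    exact ⟨fun h => hQ (by simpa using h), fun h => by rw [h, Matrix.zero_vecMul]⟩
  have h2 : (y - x) *ᵥ s.1.2 = 0 ↔ Q *ᵥ s.1.2 = 0 := by
    rw [hPQ, ← Matrix.mulVec_mulVec]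
    exact ⟨fun h => hP (by simpa using h), fun h => by rw [h, Matrix.mulVec_zero]⟩
  have h3 : s.1.1 ⬝ᵥ (y - x) *ᵥ s.1.2 = (s.1.1 ᵥ* P) ⬝ᵥ (Q *ᵥ s.1.2) := by
    rw [hPQ, ← Matrix.mulVec_mulVec, Matrix.dotProduct_mulVec]
  simp only [basisFun, ne_eq, h1, h2, h3]

theorem hat_biUnion_part (hk : 1 ≤ (graph F D N).dist x y) (hk' : (graph F D N).dist x y < D)
    (hN : D < N - D) (I : Finset (Fin 6)) :
    hat (I.biUnion (part x y)) = ∑ i ∈ I, hat (part x y i) := by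
  rw [hat, Finset.sum_biUnion]
  · rfl
  · intro i _ j _ hij
    exact part_disjoint hk hk' hN hij

theorem rankOneFourier_hat_biUnion (hk : 1 ≤ k) (hk' : k < D) (hN : D < N - D)
    (hPQ : y - x = P * Q) (hP : Function.Injective P.mulVec)
    (hQ : Function.Injective fun r => r ᵥ* Q) (I : Finset (Fin 6)) (s : NonzeroPair F D N) :
    ((Fintype.card F : ℂ) - 1) * rankOneFourier ψ (hat (I.biUnion (part x y))) s =
      ψ (s.1.1 ⬝ᵥ x *ᵥ s.1.2) * pairSum ψ
        (fun u v => (u ≠ 0 ∧ v ≠ 0) ∧ ∃ i ∈ I, kind P Q i u v) s.1.1 s.1.2 := by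
  rw [rankOneFourier_hat_of_subset (Finset.biUnion_subset.2 fun i _ => part_subset_sphere i)]
  congr 1
  refine pairSum_congr (fun u v => and_congr_right fun h => ?_) _ _
  simp only [Finset.mem_biUnion, mem_part_iff_kind hk hk' hN hPQ hP hQ h.1 h.2]

theorem mulVec_ne_zero_iff (hP : Function.Injective P.mulVec) {p : Fin k → F} :
    P *ᵥ p ≠ 0 ↔ p ≠ 0 := by
  rw [not_iff_not]
  exact ⟨fun h => hP (by simpa using h), fun h => by rw [h, Matrix.mulVec_zero]⟩

theorem vecMul_ne_zero_iff (hQ : Function.Injective fun r => r ᵥ* Q) {r : Fin k → F} :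
    r ᵥ* Q ≠ 0 ↔ r ≠ 0 := by
  rw [not_iff_not]
  exact ⟨fun h => hQ (by simpa using h), fun h => by rw [h, Matrix.zero_vecMul]⟩

theorem kind_in_in_iff (u : Fin D → F) (v : Fin (N - D) → F) :
    (∃ i ∈ ({0, 1, 2} : Finset (Fin 6)), kind P Q i u v) ↔
      (∃ p, u = P *ᵥ p) ∧ ∃ r, v = r ᵥ* Q := by
  simp only [Finset.mem_insert, Finset.mem_singleton, exists_eq_or_imp, exists_eq_left]
  constructor
  · rintro (⟨p, r, hu, hv, -⟩ | ⟨p, r, hu, hv, -⟩ | ⟨p, r, hu, hv, -⟩) <;>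
      exact ⟨⟨p, hu⟩, r, hv⟩
  · rintro ⟨⟨p, hu⟩, r, hv⟩
    by_cases h1 : p ⬝ᵥ r = 1
    · exact .inl ⟨p, r, hu, hv, h1⟩
    by_cases h0 : p ⬝ᵥ r = 0
    · exact .inr (.inl ⟨p, r, hu, hv, h0⟩)
    · exact .inr (.inr ⟨p, r, hu, hv, h0, h1⟩)

theorem kind_in_any_iff (u : Fin D → F) (v : Fin (N - D) → F) :
    (∃ i ∈ ({3, 0, 1, 2} : Finset (Fin 6)), kind P Q i u v) ↔ ∃ p, u = P *ᵥ p := by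
  rw [Finset.exists_mem_insert, kind_in_in_iff]
  change (_ ∧ _) ∨ _ ↔ _
  tauto

theorem kind_any_in_iff (u : Fin D → F) (v : Fin (N - D) → F) :
    (∃ i ∈ ({4, 0, 1, 2} : Finset (Fin 6)), kind P Q i u v) ↔ ∃ r, v = r ᵥ* Q := by
  rw [Finset.exists_mem_insert, kind_in_in_iff]
  change (_ ∧ _) ∨ _ ↔ _
  tauto

theorem injective_one_mulVec {m : Type*} [Fintype m] [DecidableEq m] :
    Function.Injective (1 : Matrix m m F).mulVec := by
  intro a b h
  simpa using h

theorem injective_vecMul_one {m : Type*} [Fintype m] [DecidableEq m] :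
    Function.Injective fun r => r ᵥ* (1 : Matrix m m F) := by
  intro a b h
  simpa using h

theorem pairSum_in_in (hP : Function.Injective P.mulVec)
    (hQ : Function.Injective fun r => r ᵥ* Q) (a : Fin D → F) (b : Fin (N - D) → F) :
    pairSum ψ (fun u v => (u ≠ 0 ∧ v ≠ 0) ∧
        ∃ i ∈ ({0, 1, 2} : Finset (Fin 6)), kind P Q i u v) a b =
      pairSum ψ (fun p r => p ≠ 0 ∧ r ≠ 0) (a ᵥ* P) (Q *ᵥ b) := by
  rw [← pairSum_factor hP hQ]
  refine pairSum_congr (fun u v => ?_) _ _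
  rw [kind_in_in_iff]
  constructor
  · rintro ⟨h, ⟨p, rfl⟩, r, rfl⟩
    exact ⟨p, r, rfl, rfl, (mulVec_ne_zero_iff hP).1 h.1, (vecMul_ne_zero_iff hQ).1 h.2⟩
  · rintro ⟨p, r, rfl, rfl, hp, hr⟩
    exact ⟨⟨(mulVec_ne_zero_iff hP).2 hp, (vecMul_ne_zero_iff hQ).2 hr⟩, ⟨p, rfl⟩, r, rfl⟩

theorem pairSum_in_any (hP : Function.Injective P.mulVec) (a : Fin D → F)
    (b : Fin (N - D) → F) :
    pairSum ψ (fun u v => (u ≠ 0 ∧ v ≠ 0) ∧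
        ∃ i ∈ ({3, 0, 1, 2} : Finset (Fin 6)), kind P Q i u v) a b =
      pairSum ψ (fun p r => p ≠ 0 ∧ r ≠ 0) (a ᵥ* P) b := by
  have h := pairSum_factor (ψ := ψ) hP (injective_vecMul_one (F := F) (m := Fin (N - D)))
    (fun p r => p ≠ 0 ∧ r ≠ 0) a b
  rw [Matrix.one_mulVec] at h
  rw [← h]
  refine pairSum_congr (fun u v => ?_) _ _
  rw [kind_in_any_iff]
  constructor
  · rintro ⟨h, p, rfl⟩
    exact ⟨p, v, rfl, by rw [Matrix.vecMul_one], (mulVec_ne_zero_iff hP).1 h.1, h.2⟩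
  · rintro ⟨p, r, rfl, rfl, hp, hr⟩
    rw [Matrix.vecMul_one]
    exact ⟨⟨(mulVec_ne_zero_iff hP).2 hp, hr⟩, p, rfl⟩

theorem pairSum_any_in (hQ : Function.Injective fun r => r ᵥ* Q) (a : Fin D → F)
    (b : Fin (N - D) → F) :
    pairSum ψ (fun u v => (u ≠ 0 ∧ v ≠ 0) ∧
        ∃ i ∈ ({4, 0, 1, 2} : Finset (Fin 6)), kind P Q i u v) a b =
      pairSum ψ (fun p r => p ≠ 0 ∧ r ≠ 0) a (Q *ᵥ b) := by
  have h := pairSum_factor (ψ := ψ) (injective_one_mulVec (F := F) (m := Fin D)) hQ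
    (fun p r => p ≠ 0 ∧ r ≠ 0) a b
  rw [Matrix.vecMul_one] at h
  rw [← h]
  refine pairSum_congr (fun u v => ?_) _ _
  rw [kind_any_in_iff]
  constructor
  · rintro ⟨h, r, rfl⟩
    exact ⟨u, r, by rw [Matrix.one_mulVec], rfl, h.1, (vecMul_ne_zero_iff hQ).1 h.2⟩
  · rintro ⟨p, r, rfl, rfl, hp, hr⟩
    rw [Matrix.one_mulVec]
    exact ⟨⟨hp, (vecMul_ne_zero_iff hQ).2 hr⟩, r, rfl⟩

theorem pairSum_kind_zero (hP : Function.Injective P.mulVec)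
    (hQ : Function.Injective fun r => r ᵥ* Q) (a : Fin D → F) (b : Fin (N - D) → F) :
    pairSum ψ (fun u v => (u ≠ 0 ∧ v ≠ 0) ∧
        ∃ i ∈ ({0} : Finset (Fin 6)), kind P Q i u v) a b =
      pairSum ψ (fun p r => p ⬝ᵥ r = 1) (a ᵥ* P) (Q *ᵥ b) := by
  rw [← pairSum_factor hP hQ]
  refine pairSum_congr (fun u v => ?_) _ _
  simp only [Finset.mem_singleton, exists_eq_left]
  constructor
  · exact And.right
  · rintro ⟨p, r, rfl, rfl, h⟩
    refine ⟨⟨(mulVec_ne_zero_iff hP).2 ?_, (vecMul_ne_zero_iff hQ).2 ?_⟩, p, r, rfl, rfl, h⟩ <;>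
    · rintro rfl
      simp at h

theorem pairSum_kind_one (hP : Function.Injective P.mulVec)
    (hQ : Function.Injective fun r => r ᵥ* Q) (a : Fin D → F) (b : Fin (N - D) → F) :
    pairSum ψ (fun u v => (u ≠ 0 ∧ v ≠ 0) ∧
        ∃ i ∈ ({1} : Finset (Fin 6)), kind P Q i u v) a b =
      pairSum ψ (fun p r => p ≠ 0 ∧ r ≠ 0 ∧ p ⬝ᵥ r = 0) (a ᵥ* P) (Q *ᵥ b) := by
  rw [← pairSum_factor hP hQ]
  refine pairSum_congr (fun u v => ?_) _ _
  simp only [Finset.mem_singleton, exists_eq_left]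
  constructor
  · rintro ⟨h0, p, r, rfl, rfl, h⟩
    exact ⟨p, r, rfl, rfl, (mulVec_ne_zero_iff hP).1 h0.1, (vecMul_ne_zero_iff hQ).1 h0.2, h⟩
  · rintro ⟨p, r, rfl, rfl, hp, hr, h⟩
    exact ⟨⟨(mulVec_ne_zero_iff hP).2 hp, (vecMul_ne_zero_iff hQ).2 hr⟩, p, r, rfl, rfl, h⟩

theorem pairSum_all (a : Fin D → F) (b : Fin (N - D) → F) :
    pairSum ψ (fun u v => (u ≠ 0 ∧ v ≠ 0) ∧
        ∃ i ∈ (Finset.univ : Finset (Fin 6)), kind P Q i u v) a b =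
      pairSum ψ (fun p r => p ≠ 0 ∧ r ≠ 0) a b := by
  refine pairSum_congr (fun u v => ?_) _ _
  obtain ⟨i, hi⟩ := exists_kind P Q u v
  simp only [Finset.mem_univ, true_and]
  exact ⟨And.left, fun h => ⟨h, i, hi⟩⟩

/-- The transforms of the `y`-partition span the six basis functions. -/
theorem basisFun_mem_span (hψ : ψ.IsPrimitive) (hk : 1 ≤ (graph F D N).dist x y)
    (hk' : (graph F D N).dist x y < D) (hD : 2 ≤ D) (hN : D < N - D) (j : Fin 6) :
    basisFun ψ x y j ∈
      Submodule.span ℝ (Set.range fun i => rankOneFourier ψ (hat (part x y i))) := by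
  set U := Submodule.span ℝ (Set.range fun i => rankOneFourier ψ (hat (part x y i)))
  have hW : ∀ I : Finset (Fin 6), rankOneFourier ψ (hat (I.biUnion (part x y))) ∈ U := by
    intro I
    rw [hat_biUnion_part hk hk' hN, map_sum]
    exact Submodule.sum_mem _ fun i _ => Submodule.subset_span ⟨i, rfl⟩
  obtain ⟨P, Q, hPQ, hP, hQ⟩ := exists_rank_factorization (y - x) rfl
  rw [dist_eq_rank, rank_sub_comm] at hk hk'
  generalize (y - x).rank = k at *
  have hq : (1 : ℝ) < Fintype.card F := by exact_mod_cast Fintype.one_lt_card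
  have hq0 : (0 : ℝ) < Fintype.card F := by linarith
  have hlt : ∀ l : ℕ, 1 ≤ l →
      (Fintype.card F : ℝ) ^ (l - 1) - (Fintype.card F : ℝ) ^ l ≠ 0 := fun l hl =>
    (sub_neg.2 (pow_lt_pow_right₀ hq (by omega))).ne
  have hpos : ∀ l : ℕ, (Fintype.card F : ℝ) ^ l ≠ 0 := fun l => (pow_pos hq0 l).ne'
  -- Extracts one function from the transform of a union of parts, once the remainder r is known to
  -- lie in U. The factor q - 1 counts pairs; q clears the denominator of the quadric sums.
  have hform : ∀ (I : Finset (Fin 6)) (j : Fin 6) (r : NonzeroPair F D N → ℂ) (c : ℝ), r ∈ U →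
      c ≠ 0 → (∀ s : NonzeroPair F D N,
        (Fintype.card F : ℂ) * (((Fintype.card F : ℂ) - 1) *
          rankOneFourier ψ (hat (I.biUnion (part x y))) s) = r s + c * basisFun ψ x y j s) →
      basisFun ψ x y j ∈ U := by
    intro I j r c hr hc h
    have h1 : ((Fintype.card F : ℝ) * ((Fintype.card F : ℝ) - 1)) •
        rankOneFourier ψ (hat (I.biUnion (part x y))) = r + c • basisFun ψ x y j := by
      ext s
      simp only [Pi.smul_apply, Pi.add_apply, Complex.real_smul]
      rw [← h s]
      push_cast
      ring
    have h2 := U.smul_mem ((Fintype.card F : ℝ) * ((Fintype.card F : ℝ) - 1)) (hW I)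
    rw [h1, Submodule.add_mem_iff_right _ hr] at h2
    exact (Submodule.smul_mem_iff _ hc).1 h2
  have hW' : ∀ (I : Finset (Fin 6)) (s : NonzeroPair F D N), _ := fun I s =>
    rankOneFourier_hat_biUnion (ψ := ψ) hk hk' hN hPQ hP hQ I s
  have hb := basisFun_eq_of_factorization (ψ := ψ) hPQ hP hQ
  -- The union of all parts is Γ(x), and E applied to its characteristic vector is θ_1 Ex̂. The
  -- coefficient is q(q - 1)θ_1, nonzero since D ≥ 2.
  have b0 : basisFun ψ x y 0 ∈ U := by
    refine hform Finset.univ 0 0 (Fintype.card F * ((Fintype.card F : ℝ) ^ D *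
      (Fintype.card F : ℝ) ^ (N - D - 1) - (Fintype.card F : ℝ) ^ (N - D)
        - (Fintype.card F : ℝ) ^ D + 1)) U.zero_mem ?_ fun s => ?_
    · have h1 : (Fintype.card F : ℝ) ^ D = Fintype.card F * (Fintype.card F : ℝ) ^ (D - 1) := by
        rw [← pow_succ', Nat.sub_add_cancel (by omega)]
      have h2 : (Fintype.card F : ℝ) ^ (N - D) =
          Fintype.card F * (Fintype.card F : ℝ) ^ (N - D - 1) := by
        rw [← pow_succ', Nat.sub_add_cancel (by omega)]
      have h3 : (Fintype.card F : ℝ) ^ (D - 1) ≤ (Fintype.card F : ℝ) ^ (N - D - 1) :=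
        pow_le_pow_right₀ hq.le (by omega)
      have h4 : (2 : ℝ) ≤ (Fintype.card F : ℝ) ^ (D - 1) := by
        have h5 : 2 ≤ Fintype.card F := Fintype.one_lt_card
        have h6 : Fintype.card F ≤ Fintype.card F ^ (D - 1) := Nat.le_self_pow (by omega) _
        exact_mod_cast h5.trans h6
      rw [h1, h2]
      apply ne_of_gt
      apply mul_pos hq0
      have h5 : 0 ≤ (Fintype.card F : ℝ) * (Fintype.card F : ℝ) ^ (N - D - 1) *
          ((Fintype.card F : ℝ) ^ (D - 1) - 2) :=
        mul_nonneg (by positivity) (by linarith)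
      have h6 : 0 ≤ (Fintype.card F : ℝ) *
          ((Fintype.card F : ℝ) ^ (N - D - 1) - (Fintype.card F : ℝ) ^ (D - 1)) :=
        mul_nonneg hq0.le (by linarith)
      nlinarith
    · rw [hW', pairSum_all, pairSum_ne_zero hψ, if_pos s.2, hb]
      simp
      ring
  -- The parts with u in the column space and v free: the sum sees only whether α = 0, as b is never
  -- zero.
  have b1 : basisFun ψ x y 1 ∈ U := by
    refine hform {3, 0, 1, 2} 1 ((Fintype.card F * ((Fintype.card F : ℝ) ^ k *
      (Fintype.card F : ℝ) ^ (N - D) - (Fintype.card F : ℝ) ^ (N - D)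
        - (Fintype.card F : ℝ) ^ k + 1) : ℝ) • basisFun ψ x y 0)
      (Fintype.card F * ((Fintype.card F : ℝ) ^ k *
        ((Fintype.card F : ℝ) ^ (N - D - 1) - (Fintype.card F : ℝ) ^ (N - D))))
      (U.smul_mem _ b0) (mul_ne_zero hq0.ne' (mul_ne_zero (hpos _) (hlt _ (by omega)))) fun s => ?_
    rw [hW', pairSum_in_any hP, pairSum_ne_zero hψ, Pi.smul_apply, hb, hb]
    by_cases h : s.1.1 ᵥ* P ≠ 0
    · simp [h, s.2.2]
      ring
    · simp [h]
      ring
  have b2 : basisFun ψ x y 2 ∈ U := by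
    refine hform {4, 0, 1, 2} 2 ((Fintype.card F * ((Fintype.card F : ℝ) ^ D *
      (Fintype.card F : ℝ) ^ k - (Fintype.card F : ℝ) ^ k
        - (Fintype.card F : ℝ) ^ D + 1) : ℝ) • basisFun ψ x y 0)
      (Fintype.card F * ((Fintype.card F : ℝ) ^ D *
        ((Fintype.card F : ℝ) ^ (k - 1) - (Fintype.card F : ℝ) ^ k)))
      (U.smul_mem _ b0) (mul_ne_zero hq0.ne' (mul_ne_zero (hpos _) (hlt _ hk))) fun s => ?_
    rw [hW', pairSum_any_in hQ, pairSum_ne_zero hψ, Pi.smul_apply, hb, hb]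
    by_cases h : Q *ᵥ s.1.2 ≠ 0
    · simp [h, s.2.1]
      ring
    · simp [h]
      ring
  -- The parts with both vectors inside: the sum sees only whether α and γ are both nonzero.
  have b3 : basisFun ψ x y 3 ∈ U := by
    refine hform {0, 1, 2} 3 ((Fintype.card F * ((Fintype.card F : ℝ) ^ k *
      (Fintype.card F : ℝ) ^ k - (Fintype.card F : ℝ) ^ k - (Fintype.card F : ℝ) ^ k + 1) : ℝ) •
        basisFun ψ x y 0) (Fintype.card F * ((Fintype.card F : ℝ) ^ k *
        ((Fintype.card F : ℝ) ^ (k - 1) - (Fintype.card F : ℝ) ^ k)))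
      (U.smul_mem _ b0) (mul_ne_zero hq0.ne' (mul_ne_zero (hpos _) (hlt _ hk))) fun s => ?_
    rw [hW', pairSum_in_in hP hQ, pairSum_ne_zero hψ, Pi.smul_apply, hb, hb]
    by_cases h : s.1.1 ᵥ* P ≠ 0 ∧ Q *ᵥ s.1.2 ≠ 0
    · simp [h]
      ring
    · simp [h]
      ring
  -- O_2 is the quadric p·r = 0 without zero vectors; its sum adds only the indicator of β ≠ 0 to
  -- functions already obtained.
  have b4 : basisFun ψ x y 4 ∈ U := by
    refine hform {1} 4 (((Fintype.card F : ℝ) ^ k * ((Fintype.card F : ℝ) ^ k +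
        (Fintype.card F : ℝ) - 1) - 2 * Fintype.card F * (Fintype.card F : ℝ) ^ k
          + Fintype.card F) • basisFun ψ x y 0 + ((Fintype.card F : ℝ) ^ k *
        ((Fintype.card F : ℝ) ^ (k - 1) - (Fintype.card F : ℝ) ^ k)) • basisFun ψ x y 3)
      ((Fintype.card F : ℝ) ^ k * ((Fintype.card F : ℝ) - 1))
      (U.add_mem (U.smul_mem _ b0) (U.smul_mem _ b3))
      (mul_ne_zero (hpos _) (by linarith)) fun s => ?_
    have h1 := card_mul_pairSum_dotProduct_eq hψ 0 (s.1.1 ᵥ* P) (Q *ᵥ s.1.2)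
    rw [hW', pairSum_kind_one hP hQ, pairSum_ne_zero_dotProduct_eq_zero, mul_left_comm, mul_add,
      mul_sub, h1, Pi.add_apply, Pi.smul_apply, Pi.smul_apply, hb, hb, hb]
    by_cases h : s.1.1 ᵥ* P ≠ 0 ∧ Q *ᵥ s.1.2 ≠ 0
    · by_cases h' : (s.1.1 ᵥ* P) ⬝ᵥ (Q *ᵥ s.1.2) ≠ 0
      · simp [h, h']
        ring
      · simp [h, h']
        ring
    · have h' : ¬(s.1.1 ᵥ* P) ⬝ᵥ (Q *ᵥ s.1.2) ≠ 0 := fun h0 =>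
        h ⟨fun h1 => h0 (by simp [h1]), fun h1 => h0 (by simp [h1])⟩
      simp [h, h']
      ring
  -- O_1 is the quadric p·r = 1, whose sum carries the term ψ(β) for β ≠ 0.
  have b5 : basisFun ψ x y 5 ∈ U := by
    refine hform {0} 5 (((Fintype.card F : ℝ) ^ k * ((Fintype.card F : ℝ) ^ k - 1)) •
        basisFun ψ x y 0 + ((Fintype.card F : ℝ) ^ k *
        ((Fintype.card F : ℝ) ^ (k - 1) - (Fintype.card F : ℝ) ^ k)) • basisFun ψ x y 3)
      ((Fintype.card F : ℝ) ^ k * ((Fintype.card F : ℝ) - 1))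
      (U.add_mem (U.smul_mem _ b0) (U.smul_mem _ b3))
      (mul_ne_zero (hpos _) (by linarith)) fun s => ?_
    have h1 := card_mul_pairSum_dotProduct_eq hψ 1 (s.1.1 ᵥ* P) (Q *ᵥ s.1.2)
    rw [hW', pairSum_kind_zero hP hQ, mul_left_comm, h1, Pi.add_apply, Pi.smul_apply,
      Pi.smul_apply, hb, hb, hb]
    by_cases h : s.1.1 ᵥ* P ≠ 0 ∧ Q *ᵥ s.1.2 ≠ 0
    · by_cases h' : (s.1.1 ᵥ* P) ⬝ᵥ (Q *ᵥ s.1.2) ≠ 0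
      · simp [h, h']
        ring
      · simp [h, h']
        ring
    · have h' : ¬(s.1.1 ᵥ* P) ⬝ᵥ (Q *ᵥ s.1.2) ≠ 0 := fun h0 =>
        h ⟨fun h1 => h0 (by simp [h1]), fun h1 => h0 (by simp [h1])⟩
      simp [h, h']
      ring
  fin_cases j
  exacts [b0, b1, b2, b3, b4, b5]

end Basis

/-! ### Independence, symmetry in x and y, and transfer back to S(x, y) -/

section Independence

variable {F : Type*} [Field F] [Fintype F] [DecidableEq F] {D N k : ℕ} {x y : Vertex F D N}
  {P : Matrix (Fin D) (Fin k) F} {Q : Matrix (Fin k) (Fin (N - D)) F} {ψ : AddChar F ℂ}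

/-- The map a ↦ aP is onto and, as k is less than the number of rows, not injective; so even α = 0
has a nonzero preimage. -/
theorem exists_ne_zero_vecMul_eq {m : Type*} [Fintype m] [DecidableEq m] (hk : k < Fintype.card m)
    {P : Matrix m (Fin k) F} (hP : Function.Injective P.mulVec) (α : Fin k → F) :
    ∃ a, a ≠ 0 ∧ a ᵥ* P = α := by
  have hs : Function.Surjective fun a => a ᵥ* P := by
    obtain ⟨g, hg⟩ := LinearMap.exists_leftInverse_of_injective P.mulVecLin
      (LinearMap.ker_eq_bot.2 hP)
    apply Matrix.vecMul_surjective_iff_exists_left_inverse.2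
    refine ⟨LinearMap.toMatrix' g, ?_⟩
    apply Matrix.toLin'.injective
    rw [Matrix.toLin'_mul, Matrix.toLin'_toMatrix', Matrix.toLin'_one]
    exact hg
  obtain ⟨a, ha⟩ := hs α
  by_cases h0 : a = 0
  · have hni : ¬Function.Injective fun a => a ᵥ* P := fun hi => by
      have := Fintype.card_le_of_injective _ hi
      rw [Fintype.card_fun, Fintype.card_fun, Fintype.card_fin] at this
      exact absurd this (not_le.2 (Nat.pow_lt_pow_right Fintype.one_lt_card hk))
    obtain ⟨b, c, hbc, hne⟩ := Function.not_injective_iff.1 hni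
    refine ⟨b - c, sub_ne_zero.2 hne, ?_⟩
    rw [← ha, h0, Matrix.sub_vecMul]
    exact (sub_eq_zero.2 hbc).trans (Matrix.zero_vecMul _).symm
  · exact ⟨a, h0, ha⟩

theorem exists_nonzeroPair (hk : k < D) (hN : D < N - D) (hP : Function.Injective P.mulVec)
    (hQ : Function.Injective fun r => r ᵥ* Q) (α γ : Fin k → F) :
    ∃ s : NonzeroPair F D N, s.1.1 ᵥ* P = α ∧ Q *ᵥ s.1.2 = γ := by
  obtain ⟨a, ha, ha'⟩ := exists_ne_zero_vecMul_eq (by simpa using hk) hP α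
  obtain ⟨b, hb, hb'⟩ := exists_ne_zero_vecMul_eq (by simpa using hk.trans hN)
    (injective_transpose_mulVec hQ) γ
  exact ⟨⟨(a, b), ha, hb⟩, ha', by rwa [Matrix.vecMul_transpose] at hb'⟩

theorem linearIndependent_basisFun (hψ : ψ.IsPrimitive) (hq : Fintype.card F ≠ 2)
    (hk : 2 ≤ (graph F D N).dist x y) (hk' : (graph F D N).dist x y < D) (hN : D < N - D) :
    LinearIndependent ℝ (basisFun ψ x y) := by
  obtain ⟨P, Q, hPQ, hP, hQ⟩ := exists_rank_factorization (y - x) rfl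
  rw [dist_eq_rank, rank_sub_comm] at hk hk'
  generalize (y - x).rank = k at *
  rw [Fintype.linearIndependent_iff]
  intro c hc
  -- All pairs (α, γ) occur, and the common factor ψ(aᵀxb) has modulus one, so a relation may be
  -- tested at freely chosen α, γ.
  have hev : ∀ α γ : Fin k → F, (c 0 : ℂ) + (if α ≠ 0 then (c 1 : ℂ) else 0) +
      (if γ ≠ 0 then (c 2 : ℂ) else 0) + (if α ≠ 0 ∧ γ ≠ 0 then (c 3 : ℂ) else 0) +
      (if α ⬝ᵥ γ ≠ 0 then (c 4 : ℂ) else 0) +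
      (if α ⬝ᵥ γ ≠ 0 then (c 5 : ℂ) * ψ (α ⬝ᵥ γ) else 0) = 0 := by
    intro α γ
    obtain ⟨s, rfl, rfl⟩ := exists_nonzeroPair hk' hN hP hQ α γ
    have h := congrFun hc s
    simp only [Finset.sum_apply, Pi.smul_apply, Complex.real_smul,
      basisFun_eq_of_factorization (ψ := ψ) hPQ hP hQ, mul_left_comm _ (ψ _), ← Finset.mul_sum,
      Pi.zero_apply] at h
    have h1 := (mul_eq_zero.1 h).resolve_left
      (by
        intro h0
        have := AddChar.norm_apply ψ (s.1.1 ⬝ᵥ x *ᵥ s.1.2)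
        rw [h0, norm_zero] at this
        exact zero_ne_one this)
    simpa [Fin.sum_univ_six] using h1
  let e : Fin k → F := Pi.single ⟨0, by omega⟩ 1
  let e' : Fin k → F := Pi.single ⟨1, by omega⟩ 1
  have he : e ≠ 0 := by simp [e]
  have he' : e' ≠ 0 := by simp [e']
  have hee : e ⬝ᵥ e = 1 := by simp [e]
  have hee' : e ⬝ᵥ e' = 0 := by simp [e, e']
  obtain ⟨t, t', ht, ht', htt⟩ := exists_apply_ne_apply hψ hq
  have h0 : (c 0 : ℂ) = 0 := by simpa using hev 0 0
  have h1 : (c 1 : ℂ) = 0 := by simpa [he, h0] using hev e 0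
  have h2 : (c 2 : ℂ) = 0 := by simpa [he, h0] using hev 0 e
  -- Needs nonzero α, γ with α·γ = 0, available because k ≥ 2.
  have h3 : (c 3 : ℂ) = 0 := by simpa [he, he', hee', h0, h1, h2] using hev e e'
  have hβ : ∀ t : F, t ≠ 0 → (c 4 : ℂ) + c 5 * ψ t = 0 := fun t ht => by
    simpa [he, hee, h0, h1, h2, h3, ht, dotProduct_smul] using hev e (t • e)
  -- Two nonzero values of β at which ψ differs separate the last two functions; they exist because
  -- q ≠ 2.
  have h5 : (c 5 : ℂ) = 0 := by
    have : (c 5 : ℂ) * (ψ t - ψ t') = 0 := by linear_combination hβ t ht - hβ t' ht'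
    exact (mul_eq_zero.1 this).resolve_right (sub_ne_zero.2 htt)
  have h4 : (c 4 : ℂ) = 0 := by simpa [h5] using hβ t ht
  intro i
  fin_cases i
  exacts [Complex.ofReal_eq_zero.1 h0, Complex.ofReal_eq_zero.1 h1, Complex.ofReal_eq_zero.1 h2,
    Complex.ofReal_eq_zero.1 h3, Complex.ofReal_eq_zero.1 h4, Complex.ofReal_eq_zero.1 h5]

theorem span_basisFun_le_swap (x y : Vertex F D N) :
    Submodule.span ℝ (Set.range (basisFun ψ x y)) ≤
      Submodule.span ℝ (Set.range (basisFun ψ y x)) := by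
  have hm : ∀ j, basisFun ψ y x j ∈ Submodule.span ℝ (Set.range (basisFun ψ y x)) :=
    fun j => Submodule.subset_span ⟨j, rfl⟩
  have hd : y - x = -(x - y) := (neg_sub x y).symm
  have hx : ∀ s : NonzeroPair F D N, ψ (s.1.1 ⬝ᵥ x *ᵥ s.1.2) =
      ψ (s.1.1 ⬝ᵥ y *ᵥ s.1.2) * ψ (s.1.1 ⬝ᵥ (x - y) *ᵥ s.1.2) := by
    intro s
    rw [← AddChar.map_add_eq_mul, ← dotProduct_add, ← Matrix.add_mulVec, add_sub_cancel]
  have h1 : ∀ s : NonzeroPair F D N, s.1.1 ⬝ᵥ (x - y) *ᵥ s.1.2 ≠ 0 →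
      s.1.1 ᵥ* (x - y) ≠ 0 ∧ (x - y) *ᵥ s.1.2 ≠ 0 := by
    intro s h
    refine ⟨fun h0 => h ?_, fun h0 => h ?_⟩
    · rw [Matrix.dotProduct_mulVec, h0, zero_dotProduct]
    · rw [h0, dotProduct_zero]
  -- With β' = aᵀ(x - y)b one has ψ(β') = 1 - [β' ≠ 0] + [β' ≠ 0]ψ(β'). Multiplying by any of the
  -- first four indicators changes only the leading 1, since β' ≠ 0 forces a(x - y) and (x - y)b to
  -- be nonzero.
  have hlow : ∀ j : Fin 6, j < 4 →
      basisFun ψ x y j = basisFun ψ y x j - basisFun ψ y x 4 + basisFun ψ y x 5 := by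
    intro j hj
    ext s
    simp only [basisFun, Pi.sub_apply, Pi.add_apply, hx s, hd, Matrix.vecMul_neg,
      Matrix.neg_mulVec, neg_ne_zero, dotProduct_neg]
    by_cases hβ : s.1.1 ⬝ᵥ (x - y) *ᵥ s.1.2 ≠ 0
    · have h2 := h1 s hβ
      fin_cases j
      · simp [hβ]
      · simp [hβ, h2]
      · simp [hβ, h2]
      · simp [hβ, h2]
      · exact absurd hj (by decide)
      · exact absurd hj (by decide)
    · rw [not_not] at hβ
      simp [hβ]
  have h4 : basisFun ψ x y 4 = basisFun ψ y x 5 := by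
    ext s
    simp only [basisFun, hx s, hd, Matrix.vecMul_neg,
      Matrix.neg_mulVec, neg_ne_zero, dotProduct_neg]
    by_cases hβ : s.1.1 ⬝ᵥ (x - y) *ᵥ s.1.2 ≠ 0 <;> simp [hβ]
  have h5 : basisFun ψ x y 5 = basisFun ψ y x 4 := by
    ext s
    simp only [basisFun, hx s, hd, Matrix.vecMul_neg,
      Matrix.neg_mulVec, neg_ne_zero, dotProduct_neg]
    by_cases hβ : s.1.1 ⬝ᵥ (x - y) *ᵥ s.1.2 ≠ 0
    · simp [hβ, ← AddChar.map_add_eq_mul]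
    · simp [hβ]
  rw [Submodule.span_le]
  rintro _ ⟨j, rfl⟩
  rcases (by omega : j < 4 ∨ j = 4 ∨ j = 5) with h | rfl | rfl
  · rw [hlow j h]
    exact Submodule.add_mem _ (Submodule.sub_mem _ (hm _) (hm _)) (hm _)
  · rw [h4]
    exact hm _
  · rw [h5]
    exact hm _

theorem span_basisFun_comm (x y : Vertex F D N) :
    Submodule.span ℝ (Set.range (basisFun ψ x y)) =
      Submodule.span ℝ (Set.range (basisFun ψ y x)) :=
  le_antisymm (span_basisFun_le_swap x y) (span_basisFun_le_swap y x)

/-- The six transforms span a space containing six independent functions, so the dimensions force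
equality. -/
theorem span_rankOneFourier_part (hψ : ψ.IsPrimitive) (hq : Fintype.card F ≠ 2)
    (hk : 2 ≤ (graph F D N).dist x y) (hk' : (graph F D N).dist x y < D) (hN : D < N - D) :
    Submodule.span ℝ (Set.range fun i => rankOneFourier ψ (hat (part x y i))) =
      Submodule.span ℝ (Set.range (basisFun ψ x y)) := by
  symm
  apply Submodule.eq_of_le_of_finrank_le
  · rw [Submodule.span_le]
    rintro _ ⟨j, rfl⟩
    exact basisFun_mem_span hψ (by omega) hk' (by omega) hN j
  · rw [finrank_span_eq_card (linearIndependent_basisFun hψ hq hk hk' hN)]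
    exact finrank_range_le_card _

/-- Both sides say that w agrees with a combination of the Ô_i modulo the common kernel of E and
`rankOneFourier`. -/
theorem mulVec_mem_S_iff (hψ : ψ.IsPrimitive) (hq : Fintype.card F ≠ 2)
    (hk : 2 ≤ (graph F D N).dist x y) (hk' : (graph F D N).dist x y < D) (hN : D < N - D)
    (w : Vertex F D N → ℝ) :
    idem F D N *ᵥ w ∈ S x y ↔
      rankOneFourier ψ w ∈ Submodule.span ℝ (Set.range (basisFun ψ x y)) := by
  have hS : S x y = (Submodule.span ℝ (Set.range fun i => hat (part x y i))).map
      (idem F D N).mulVecLin := by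
    rw [Submodule.map_span, ← Set.range_comp]
    rfl
  have hT : Submodule.span ℝ (Set.range (basisFun ψ x y)) =
      (Submodule.span ℝ (Set.range fun i => hat (part x y i))).map (rankOneFourier ψ) := by
    rw [Submodule.map_span, ← Set.range_comp, ← span_rankOneFourier_part hψ hq hk hk' hN]
    rfl
  have hiff : ∀ w', idem F D N *ᵥ w' = idem F D N *ᵥ w ↔
      rankOneFourier ψ w' = rankOneFourier ψ w := by
    intro w'
    rw [← sub_eq_zero, ← Matrix.mulVec_sub, idem_mulVec_eq_zero_iff hψ (by omega) (by omega),
      map_sub, sub_eq_zero]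
  rw [hS, hT, Submodule.mem_map, Submodule.mem_map]
  exact exists_congr fun w' => and_congr_right fun _ => hiff w'

theorem S_le_EV (x y : Vertex F D N) : S x y ≤ EV F D N := by
  rw [S, Submodule.span_le]
  rintro _ ⟨i, rfl⟩
  exact ⟨_, rfl⟩

theorem S_comm (hq : Fintype.card F ≠ 2) (hk : 2 ≤ (graph F D N).dist x y)
    (hk' : (graph F D N).dist x y < D) (hN : D < N - D) : S x y = S y x := by
  obtain ⟨ψ, hψ⟩ := exists_isPrimitive_addChar F
  have h : ∀ w, idem F D N *ᵥ w ∈ S x y ↔ idem F D N *ᵥ w ∈ S y x := by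
    intro w
    rw [mulVec_mem_S_iff hψ hq hk hk' hN, span_basisFun_comm, ← mulVec_mem_S_iff hψ hq
      (by rwa [SimpleGraph.dist_comm]) (by rwa [SimpleGraph.dist_comm]) hN]
  apply le_antisymm
  · intro s hs
    obtain ⟨w, rfl⟩ := S_le_EV x y hs
    exact (h w).1 hs
  · intro s hs
    obtain ⟨w, rfl⟩ := S_le_EV y x hs
    exact (h w).2 hs

theorem linearIndependent_partVec (hq : Fintype.card F ≠ 2) (hk : 2 ≤ (graph F D N).dist x y)
    (hk' : (graph F D N).dist x y < D) (hN : D < N - D) : LinearIndependent ℝ (partVec x y) := by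
  obtain ⟨ψ, hψ⟩ := exists_isPrimitive_addChar F
  have h : LinearIndependent ℝ fun i => rankOneFourier ψ (hat (part x y i)) := by
    rw [linearIndependent_iff_card_eq_finrank_span, Set.finrank,
      span_rankOneFourier_part hψ hq hk hk' hN,
      finrank_span_eq_card (linearIndependent_basisFun hψ hq hk hk' hN)]
  rw [Fintype.linearIndependent_iff] at h ⊢
  intro c hc
  apply h c
  have h1 : idem F D N *ᵥ (∑ i, c i • hat (part x y i)) = 0 := by
    rw [← hc, ← Matrix.mulVecLin_apply, map_sum]
    simp only [map_smul]
    rfl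
  rw [idem_mulVec_eq_zero_iff hψ (by omega) (by omega), map_sum] at h1
  simpa only [map_smul] using h1

theorem idem_mulVec_single_mem_S (hq : Fintype.card F ≠ 2) (hk : 2 ≤ (graph F D N).dist x y)
    (hk' : (graph F D N).dist x y < D) (hN : D < N - D) :
    idem F D N *ᵥ Pi.single x 1 ∈ S x y := by
  obtain ⟨ψ, hψ⟩ := exists_isPrimitive_addChar F
  rw [mulVec_mem_S_iff hψ hq hk hk' hN]
  refine Submodule.subset_span ⟨0, ?_⟩
  ext s
  have h : (Pi.single x 1 : Vertex F D N → ℝ) = hat {x} := by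
    rw [hat, Finset.sum_singleton]
  rw [h, rankOneFourier_apply, fourier_hat, Finset.sum_singleton, pairing_vecMulVec_left]
  simp [basisFun]

end Independence

end BilinearForms

theorem proposition8p6 (F : Type*) [Field F] [Fintype F] [DecidableEq F]
    (hq : Fintype.card F ≠ 2) (D N : ℕ) (hD : 6 ≤ 2 * D) (hN : 2 * D < N)
    (x y : BilinearForms.Vertex F D N)
    (hk : 2 ≤ (BilinearForms.graph F D N).dist x y)
    (hk' : (BilinearForms.graph F D N).dist x y ≤ D - 1) :
    (∀ i, (BilinearForms.part x y i).Nonempty) ∧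
    (∀ i j, i ≠ j → Disjoint (BilinearForms.part x y i) (BilinearForms.part x y j)) ∧
    Finset.univ.biUnion (BilinearForms.part x y) =
      BilinearForms.sphere (BilinearForms.graph F D N) 1 x ∧
    BilinearForms.S x y = BilinearForms.S y x ∧
    LinearIndependent ℝ (BilinearForms.partVec x y) ∧
    LinearIndependent ℝ (BilinearForms.partVec y x) ∧
    Module.finrank ℝ (BilinearForms.S x y) = 6 ∧
    BilinearForms.S x y ≤ BilinearForms.EV F D N ∧
    (BilinearForms.idem F D N).mulVec (Pi.single x 1) ∈ BilinearForms.S x y ∧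
    (BilinearForms.idem F D N).mulVec (Pi.single y 1) ∈ BilinearForms.S x y := by
  have hlt : (BilinearForms.graph F D N).dist x y < D := by omega
  have hN' : D < N - D := by omega
  have hk2 := hk
  have hlt2 := hlt
  rw [SimpleGraph.dist_comm] at hk2 hlt2
  have hS := BilinearForms.S_comm hq hk hlt hN'
  have hli := BilinearForms.linearIndependent_partVec hq hk hlt hN'
  refine ⟨BilinearForms.part_nonempty hq hk hlt hN',
    fun i j => BilinearForms.part_disjoint (by omega) hlt hN',
    BilinearForms.biUnion_part (by omega), hS, hli,
    BilinearForms.linearIndependent_partVec hq hk2 hlt2 hN', ?_, BilinearForms.S_le_EV x y,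
    BilinearForms.idem_mulVec_single_mem_S hq hk hlt hN', ?_⟩
  · rw [BilinearForms.S, finrank_span_eq_card hli, Fintype.card_fin]
  · rw [hS]
    exact BilinearForms.idem_mulVec_single_mem_S hq hk2 hlt2 hN'
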